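/- Setting. For integers $n,M\ge 0$ let $S\subseteq[M]^n$, where a string $x\in[M]^n$ is viewed as a function $x:[n]\to[M]$, and let $f:S\to\{0,1\}$. The function $f$ is permutation symmetric of the first type if for every $x\in S$ and every permutation $\pi$ of $[n]$ we have $x\circ\pi\in S$ and $f(x\circ\pi)=f(x)$. The randomized query complexity $R(f)$ is the least $q$ such that some randomized classical algorithm making at most $q$ queries $i\mapsto x_i$ (counted in the worst case) outputs $f(x)$ with probability at least $2/3$ for every $x\in S$. The quantum query complexity $Q(f)$ is the least $q$ such that some quantum algorithm making $q$ applications of the unitary $|i\rangle|j\rangle\mapsto|i\rangle|j+x_i \bmod M\rangle$ outputs $f(x)$ with probability at least $2/3$ for every $x\in S$ (in the degenerate cases $n=0$ or $M=0$, where there is no quantum register, $Q(f)=0$). Call a real number $\Lambda>0$ a Zhandry constant if for all integers $1\le r\le n$, every quantum algorithm $\mathcal B$ making at most $\Lambda r^{1/3}$ queries to a function $[n]\to[n]$, and every $b\in\{0,1\}$, $$\left|\mathbb E_{\pi}\Pr[\mathcal B^{\pi}\text{ outputs }b]-\mathbb E_{g,h}\Pr[\mathcal B^{h\circ g}\text{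 outputs }b]\right|\le\frac{2}{27},$$ where $\pi$ is a uniformly random permutation of $[n]$, $g:[n]\to[r]$ is a uniformly random function, and $h:[r]\to[n]$ is an independent uniformly random injection. Theorem. A Zhandry constant exists. For every Zhandry constant $\Lambda$ and every $f:S\to\{0,1\}$, $S\subseteq[M]^n$, that is permutation symmetric of the first type, $$R(f)\le\left\lceil 216\,Q(f)^3\,\Lambda^{-3}\right\rceil .$$ In particular there is an absolute constant $K>0$, independent of $n$, $M$, $S$ and $f$, such that $R(f)\le K\,Q(f)^3$ for all such $f$. -/

import Mathlib

noncomputable section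

namespace QueryComplexity

open scoped BigOperators Matrix ENNReal

/-! ### Classical randomized query algorithms -/

/-- A deterministic classical query algorithm with Boolean output on inputs `x : [n] → [M]`:
either stop and output a bit, or query a position `i` and continue depending on the answer. -/
inductive DecisionTree (n M : ℕ) : Type
  | leaf (b : Bool) : DecisionTree n M
  | query (i : Fin n) (next : Fin M → DecisionTree n M) : DecisionTree n M

/-- The output of the algorithm when its queries are answered by `x`. -/
def DecisionTree.eval {n M : ℕ} (x : Fin n → Fin M) : DecisionTree n M → Bool
  | .leaf b => b
  | .query i next => (next (x i)).eval x

/-- The worst-case number of queries. -/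
def DecisionTree.depth {n M : ℕ} : DecisionTree n M → ℕ
  | .leaf _ => 0
  | .query _ next => 1 + Finset.univ.sup fun a => (next a).depth

/-- Some randomized algorithm (a probability distribution over deterministic ones) making at most
`q` queries outputs `f x` with probability at least `2/3`, for every `x` in the domain of `f`. -/
def RandomizedComputable {n M : ℕ} {S : Set (Fin n → Fin M)} (f : S → Bool) (q : ℕ) : Prop :=
  ∃ A : PMF (DecisionTree n M), (∀ T ∈ A.support, T.depth ≤ q) ∧
    ∀ x : S, (2 / 3 : ℝ≥0∞) ≤ (A.map fun T => T.eval x.1) (f x)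

/-- The randomized query complexity `R(f)`. -/
def R {n M : ℕ} {S : Set (Fin n → Fin M)} (f : S → Bool) : ℕ :=
  sInf {q | RandomizedComputable f q}

/-! ### Quantum query algorithms -/

/-- The computational basis `|i⟩|j⟩|k⟩`: a query position, an answer register, and a workspace
of dimension `w`. -/
abbrev QBasis (n M w : ℕ) : Type := Fin n × Fin M × Fin w

/-- The quantum oracle `|i⟩|j⟩|k⟩ ↦ |i⟩|j + x i⟩|k⟩`, addition being modulo `M`. -/
def oracle {n M : ℕ} (w : ℕ) (x : Fin n → Fin M) : Matrix (QBasis n M w) (QBasis n M w) ℂ :=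
  Matrix.of fun b' b => if b' = (b.1, b.2.1 + x b.1, b.2.2) then 1 else 0

/-- A quantum query algorithm: start in the basis state `start`, apply
`U 0, 𝒪, U 1, 𝒪, …, 𝒪, U queries` (with `queries` applications of the oracle `𝒪`), measure in the
computational basis and output the bit `out` of the measurement result. The unitaries
`U k` with `k > queries` play no role. -/
structure QuantumAlgorithm (n M : ℕ) where
  queries : ℕ
  workDim : ℕ
  start : QBasis n M workDim
  U : ℕ → Matrix.unitaryGroup (QBasis n M workDim) ℂ
  out : QBasis n M workDim → Bool

/-- The state after `k` queries to the oracle of `x` and the application of `U k`. -/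
def QuantumAlgorithm.state {n M : ℕ} (A : QuantumAlgorithm n M) (x : Fin n → Fin M) :
    ℕ → (QBasis n M A.workDim → ℂ)
  | 0 => (A.U 0).1 *ᵥ Pi.single A.start 1
  | k + 1 => (A.U (k + 1)).1 *ᵥ (oracle A.workDim x *ᵥ A.state x k)

/-- The probability that the algorithm, run with the oracle of `x`, outputs `b`. -/
def QuantumAlgorithm.prob {n M : ℕ} (A : QuantumAlgorithm n M) (x : Fin n → Fin M) (b : Bool) : ℝ :=
  ∑ v with A.out v = b, ‖A.state x A.queries v‖ ^ 2

/-- Some quantum algorithm making `q` queries outputs `f x` with probability at least `2/3`, for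
every `x` in the domain of `f`. -/
def QuantumComputable {n M : ℕ} {S : Set (Fin n → Fin M)} (f : S → Bool) (q : ℕ) : Prop :=
  ∃ A : QuantumAlgorithm n M, A.queries = q ∧ ∀ x : S, 2 / 3 ≤ A.prob x.1 (f x)

/-- The quantum query complexity `Q(f)`. -/
def Q {n M : ℕ} {S : Set (Fin n → Fin M)} (f : S → Bool) : ℕ :=
  sInf {q | QuantumComputable f q}

/-! ### Permutation symmetry and Zhandry's constant -/

/-- `f` is permutation symmetric of the first type: its domain is stable under permutations of the
positions and `f (x ∘ π) = f x`. -/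
def PermutationSymmetric {n M : ℕ} {S : Set (Fin n → Fin M)} (f : S → Bool) : Prop :=
  ∀ (π : Equiv.Perm (Fin n)) (x : S), ∃ h : x.1 ∘ π ∈ S, f ⟨x.1 ∘ π, h⟩ = f x

/-- The expectation of `F` at a uniformly random permutation of `[n]`. -/
def expectPerm (n : ℕ) (F : (Fin n → Fin n) → ℝ) : ℝ :=
  𝔼 π : Equiv.Perm (Fin n), F π

/-- The expectation of `F` at the small-range function `h ∘ g`, where `g : [n] → [r]` is a uniformly
random function and `h : [r] → [n]` an independent uniformly random injection. -/
def expectSmallRange (n r : ℕ) (F : (Fin n → Fin n) → ℝ) : ℝ :=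
  𝔼 g : Fin n → Fin r, 𝔼 h : Fin r ↪ Fin n, F (h ∘ g)

/-- `Λ > 0` is an absolute constant for the hardness of distinguishing a random permutation of `[n]`
from a random function of range at most `r`: no quantum algorithm making at most `Λ r^{1/3}`
queries has advantage more than `2/27`. -/
def IsZhandryConstant (Λ : ℝ) : Prop :=
  0 < Λ ∧ ∀ n r : ℕ, 1 ≤ r → r ≤ n → ∀ B : QuantumAlgorithm n n,
    (B.queries : ℝ) ≤ Λ * (r : ℝ) ^ (1 / 3 : ℝ) → ∀ b : Bool,
      |expectPerm n (fun π => B.prob π b) - expectSmallRange n r (fun C => B.prob C b)| ≤ 2 / 27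

end QueryComplexity

end

/-!
A Zhandry constant exists by the polynomial method. After `q` queries the acceptance probability is a
polynomial of degree at most `2 q` in the indicators of `C i = y`
(`QuantumAlgorithm.prob_mem_constraintSpan`). The expectation of a product of `k` such indicators at the
small-range function `h ∘ g` is a polynomial of degree at most `k` in `1 / r`, and the value of that
polynomial at `0` is the expectation at a random permutation (`isInterpolated_constraintIndicator`).
So the two expectations to be compared are `P (1 / r)` and `P 0`, for a polynomial `P` of degree
`d ≤ 2 q` with `P (1 / s) ∈ [0, 1]` for all integers `1 ≤ s ≤ r`. Lagrange interpolation at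
`1 / r` and at the reciprocals of the integers `⌊4 d³ / j²⌋`, `1 ≤ j ≤ d`, gives
`|P 0 - P (1 / r)| ≤ 32 d³ / r` (`norm_eval_zero_sub_le`), because the Lagrange weights are those
of the nodes `j²`, up to rounding errors which the Gaussian decay of these weights absorbs.

For the bound on `R f`, take an optimal quantum algorithm `A` for `f` and the majority vote of three
runs of `A`, which errs with probability at most `7/27`. Run on `x ∘ C`, the vote is an algorithm
with `6 Q f` queries to `C` (`exists_majority_algorithm`), as a query to `x ∘ C` is a query to `C` followed
by one that uncomputes it. For a random permutation `C = π` the symmetry of `f` makes the vote correct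
with probability at least `20/27`. By the definition of a Zhandry constant `Λ`, it is correct with
probability at least `18/27 = 2/3` for a random `C = h ∘ g` as soon as `6 Q f ≤ Λ r ^ (1/3)`. But
`x ∘ h ∘ g` only depends on the values of `x` at the `r` points in the range of `h`, so that a classical
algorithm can query these and simulate the rest
(`randomizedComputable_of_quantumComputable`).
-/

/-! ### Extrapolating a polynomial from reciprocals of integers to zero -/

noncomputable section

namespace QueryComplexity

open Finset Polynomial
open scoped Nat

/-- The Lagrange weights at `0` of the nodes `1², …, d²`: the product is
`2 (d!)² / ((d - j)! (d + j)!)`. -/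
theorem prod_sq_div_sq_sub_sq (j : ℕ) (hj : 1 ≤ j) (d : ℕ) (hd : j ≤ d) :
    (∏ i ∈ (Icc 1 d).erase j, (i : ℝ) ^ 2 / |(i : ℝ) ^ 2 - (j : ℝ) ^ 2|) *
      ((d - j)! * (d + j)!) = 2 * (d ! : ℝ) ^ 2 := by
  induction d, hd using Nat.le_induction with
  | base =>
    have aux : ∀ m : ℕ, m < j → (∏ i ∈ Icc 1 m, (i : ℝ) ^ 2 / |(i : ℝ) ^ 2 - (j : ℝ) ^ 2|) *
        ((j + m)! * (j - 1)!) = (m ! : ℝ) ^ 2 * j ! * (j - 1 - m)! := by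
      intro m
      induction m with
      | zero => intro _; simp
      | succ m ih =>
        intro hm
        have ih := ih (by omega)
        obtain ⟨k, rfl⟩ : ∃ k, j = m + 1 + 1 + k := ⟨j - (m + 1) - 1, by omega⟩
        rw [prod_Icc_succ_top (by omega)]
        have e1 : m + 1 + 1 + k - 1 - m = k + 1 := by omega
        have e2 : m + 1 + 1 + k - 1 - (m + 1) = k := by omega
        rw [e1, Nat.factorial_succ k] at ih
        rw [e2, ← add_assoc (m + 1 + 1 + k) m 1, Nat.factorial_succ (m + 1 + 1 + k + m),
          Nat.factorial_succ m]
        have e3 : |((m + 1 : ℕ) : ℝ) ^ 2 - ((m + 1 + 1 + k : ℕ) : ℝ) ^ 2| =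
            ((k : ℝ) + 1) * ((m + 1 + 1 + k + m + 1 : ℕ) : ℝ) := by
          rw [abs_of_nonpos]
          · push_cast; ring
          · push_cast; nlinarith [Nat.cast_nonneg (α := ℝ) m, Nat.cast_nonneg (α := ℝ) k]
        rw [e3]
        have h1 : ((m + 1 + 1 + k + m + 1 : ℕ) : ℝ) ≠ 0 := by positivity
        have h2 : (k : ℝ) + 1 ≠ 0 := by positivity
        push_cast at ih ⊢
        push_cast at h1
        field_simp
        linear_combination ih
    obtain ⟨k, rfl⟩ : ∃ k, j = k + 1 := ⟨j - 1, by omega⟩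
    have h := aux k (by omega)
    have e : (Icc 1 (k + 1)).erase (k + 1) = Icc 1 k := by
      ext i; simp only [mem_erase, mem_Icc]; omega
    rw [e]
    simp only [Nat.add_sub_cancel, Nat.sub_self, Nat.factorial_zero, Nat.cast_one, one_mul,
      mul_one] at h ⊢
    rw [← add_assoc (k + 1) k 1, Nat.factorial_succ (k + 1 + k), Nat.factorial_succ k] at *
    have hk : (k ! : ℝ) ≠ 0 := by positivity
    push_cast at h ⊢
    apply mul_left_cancel₀ hk
    linear_combination (2 * (k : ℝ) + 2) * h
  | succ d hd ih =>
    have e : (Icc 1 (d + 1)).erase j = insert (d + 1) ((Icc 1 d).erase j) := by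
      ext i; simp only [mem_erase, mem_Icc, mem_insert]; omega
    rw [e, prod_insert (by simp)]
    obtain ⟨k, rfl⟩ : ∃ k, d = j + k := ⟨d - j, by omega⟩
    have e1 : j + k - j = k := by omega
    have e2 : j + k + 1 - j = k + 1 := by omega
    have e4 : j + k + 1 + j = (j + k + j) + 1 := by omega
    rw [e1] at ih
    rw [e2, e4, Nat.factorial_succ k, Nat.factorial_succ (j + k + j), Nat.factorial_succ (j + k)]
    have e3 : |((j + k + 1 : ℕ) : ℝ) ^ 2 - (j : ℝ) ^ 2| =
        ((k : ℝ) + 1) * ((j + k + j + 1 : ℕ) : ℝ) := by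
      rw [abs_of_nonneg]
      · push_cast; ring
      · push_cast; nlinarith [Nat.cast_nonneg (α := ℝ) j, Nat.cast_nonneg (α := ℝ) k]
    rw [e3]
    have h1 : ((j + k + j + 1 : ℕ) : ℝ) ≠ 0 := by positivity
    have h2 : (k : ℝ) + 1 ≠ 0 := by positivity
    push_cast at ih h1 ⊢
    field_simp
    linear_combination ih

/-- The Gaussian decay of `(d!)² / ((d - j)! (d + j)!)`. It pays for the rounding of the nodes in
`prod_node_le`. -/
theorem factorial_sq_le_exp (d j : ℕ) (hj : j ≤ d) :
    (d ! : ℝ) ^ 2 ≤ Real.exp (-((j : ℝ) ^ 2 / (2 * d))) * ((d - j)! * (d + j)!) := by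
  induction j with
  | zero => simp [sq]
  | succ j ih =>
    have ih := ih (by omega)
    obtain ⟨k, rfl⟩ : ∃ k, d = j + 1 + k := ⟨d - (j + 1), by omega⟩
    have e1 : j + 1 + k - j = k + 1 := by omega
    have e2 : j + 1 + k - (j + 1) = k := by omega
    rw [e1, Nat.factorial_succ] at ih
    rw [e2, ← add_assoc (j + 1 + k) j 1, Nat.factorial_succ (j + 1 + k + j)]
    refine ih.trans ?_
    set D : ℝ := ((j + 1 + k : ℕ) : ℝ) with hD
    have hD' : D = j + 1 + k := by rw [hD]; push_cast; ring
    have hDpos : 0 < D := by rw [hD]; positivity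
    have hexp : Real.exp (-(((j + 1 : ℕ) : ℝ) ^ 2 / (2 * D))) =
        Real.exp (-((j : ℝ) ^ 2 / (2 * D))) * Real.exp (-((2 * j + 1) / (2 * D))) := by
      rw [← Real.exp_add]; congr 1; push_cast; field_simp; ring
    rw [hexp]
    have key : (k : ℝ) + 1 ≤ Real.exp (-((2 * j + 1) / (2 * D))) * (D + j + 1) := by
      have h1 : (0 : ℝ) < D + j + 1 := by positivity
      have h2 : 1 - (2 * (j : ℝ) + 1) / (D + j + 1) ≤ Real.exp (-((2 * j + 1) / (2 * D))) := by
        have := Real.add_one_le_exp (-((2 * (j : ℝ) + 1) / (2 * D)))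
        refine le_trans ?_ this
        have : (2 * (j : ℝ) + 1) / (2 * D) ≤ (2 * (j : ℝ) + 1) / (D + j + 1) := by
          apply div_le_div_of_nonneg_left (by positivity) h1
          have : (0 : ℝ) ≤ k := by positivity
          linarith
        linarith
      calc (k : ℝ) + 1 = (1 - (2 * (j : ℝ) + 1) / (D + j + 1)) * (D + j + 1) := by
            field_simp; rw [hD']; ring
        _ ≤ _ := by gcongr
    have e5 : ((j + 1 + k + j + 1 : ℕ) : ℝ) = D + j + 1 := by rw [hD]; push_cast; ring
    push_cast at *
    rw [← e5] at key
    have hE := Real.exp_pos (-((j : ℝ) ^ 2 / (2 * D)))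
    calc _ = Real.exp (-((j : ℝ) ^ 2 / (2 * D))) * ((k : ℝ) + 1) * (k ! * (j + 1 + k + j)!) := by
          ring
      _ ≤ Real.exp (-((j : ℝ) ^ 2 / (2 * D))) * (Real.exp (-((2 * j + 1) / (2 * D))) *
            (↑j + 1 + ↑k + ↑j + 1)) * (k ! * (j + 1 + k + j)!) := by gcongr
      _ = _ := by ring

theorem prod_sq_div_le (d j : ℕ) (hj : 1 ≤ j) (hd : j ≤ d) :
    ∏ i ∈ (Icc 1 d).erase j, (i : ℝ) ^ 2 / |(i : ℝ) ^ 2 - (j : ℝ) ^ 2| ≤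
      2 * Real.exp (-((j : ℝ) ^ 2 / (2 * d))) := by
  have h1 := prod_sq_div_sq_sub_sq j hj d hd
  have h2 := factorial_sq_le_exp d j hd
  have hpos : (0 : ℝ) < (d - j)! * (d + j)! := by positivity
  refine le_of_mul_le_mul_right ?_ hpos
  rw [h1]
  linarith

/-- The `j`-th integer `s` at whose reciprocal a polynomial of degree `d` is sampled. The points
`1 / s` are close to `j² / (4 d³)`, so they are spaced like Chebyshev nodes near `0`, while distinct
nodes stay distinct after rounding down. -/
def node (d j : ℕ) : ℕ := 4 * d ^ 3 / j ^ 2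

theorem node_le (d j : ℕ) : (node d j : ℝ) ≤ 4 * (d : ℝ) ^ 3 / (j : ℝ) ^ 2 := by
  have := @Nat.cast_div_le ℝ _ _ _ (4 * d ^ 3) (j ^ 2)
  simpa [node] using this

theorem lt_node_add_one (d j : ℕ) (hj : 1 ≤ j) :
    4 * (d : ℝ) ^ 3 / (j : ℝ) ^ 2 < node d j + 1 := by
  have h := Nat.lt_div_mul_add (a := 4 * d ^ 3) (b := j ^ 2) (by positivity)
  have h' : ((4 * d ^ 3 : ℕ) : ℝ) < ((4 * d ^ 3 / j ^ 2 * j ^ 2 + j ^ 2 : ℕ) : ℝ) := by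
    exact_mod_cast h
  rw [div_lt_iff₀ (by positivity)]
  unfold node
  push_cast at h' ⊢
  linarith

theorem one_le_node (d j : ℕ) (hj : 1 ≤ j) (hd : j ≤ d) : 1 ≤ node d j := by
  unfold node
  rw [Nat.one_le_div_iff (by positivity)]
  calc j ^ 2 ≤ d ^ 2 := by gcongr
    _ ≤ 4 * d ^ 3 := by
      have : 1 ≤ d := by omega
      nlinarith [Nat.pos_of_ne_zero (show d ^ 2 ≠ 0 by positivity)]

/-- Without rounding, the ratio would be exactly `i² / |i² - j²|`. Two unrounded nodes differ by
`4 d³ |i² - j²| / (i² j²)`, which is at least `4` and at least `4 d² / j²`; rounding changes the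
difference by at most `1`, hence the ratio by at most the exponential factor. -/
theorem node_factor_le (d i j : ℕ) (hi : 1 ≤ i) (hid : i ≤ d) (hj : 1 ≤ j) (hjd : j ≤ d)
    (hij : i ≠ j) :
    0 < |(node d j : ℝ) - node d i| ∧
    (node d j : ℝ) / |(node d j : ℝ) - node d i| ≤
      (i : ℝ) ^ 2 / |(i : ℝ) ^ 2 - (j : ℝ) ^ 2| * Real.exp ((j : ℝ) ^ 2 / (2 * (d : ℝ) ^ 2)) := by
  have hi' : (1 : ℝ) ≤ i := by exact_mod_cast hi
  have hj' : (1 : ℝ) ≤ j := by exact_mod_cast hj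
  have hid' : (i : ℝ) ≤ d := by exact_mod_cast hid
  have hjd' : (j : ℝ) ≤ d := by exact_mod_cast hjd
  have hd' : (1 : ℝ) ≤ d := hi'.trans hid'
  have hgap : (i : ℝ) + j ≤ |(i : ℝ) ^ 2 - (j : ℝ) ^ 2| := by
    have h1 : (1 : ℝ) ≤ |(i : ℝ) - j| := by
      have : (1 : ℤ) ≤ |(i : ℤ) - j| := Int.one_le_abs (by omega)
      exact_mod_cast this
    have h2 : (i : ℝ) ^ 2 - (j : ℝ) ^ 2 = (i - j) * (i + j) := by ring
    rw [h2, abs_mul, abs_of_nonneg (show (0 : ℝ) ≤ i + j by positivity)]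
    nlinarith
  set G := |(i : ℝ) ^ 2 - (j : ℝ) ^ 2| with hG
  have hGpos : 0 < G := by linarith
  -- `A` is the distance of the two unrounded nodes
  set A := 4 * (d : ℝ) ^ 3 * G / ((i : ℝ) ^ 2 * (j : ℝ) ^ 2) with hA
  have hApos : 0 < A := by positivity
  have hdiff : A = |4 * (d : ℝ) ^ 3 / (j : ℝ) ^ 2 - 4 * (d : ℝ) ^ 3 / (i : ℝ) ^ 2| := by
    have : 4 * (d : ℝ) ^ 3 / (j : ℝ) ^ 2 - 4 * (d : ℝ) ^ 3 / (i : ℝ) ^ 2 =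
        4 * (d : ℝ) ^ 3 / ((i : ℝ) ^ 2 * (j : ℝ) ^ 2) * ((i : ℝ) ^ 2 - (j : ℝ) ^ 2) := by
      field_simp
    rw [this, abs_mul, ← hG, abs_of_nonneg (by positivity), hA]
    ring
  have hinvA : 1 / A ≤ (j : ℝ) ^ 2 / (4 * (d : ℝ) ^ 2) := by
    rw [hA, one_div, inv_div, div_le_div_iff₀ (by positivity) (by positivity)]
    have : (i : ℝ) ^ 2 ≤ d * G := by nlinarith
    calc (i : ℝ) ^ 2 * (j : ℝ) ^ 2 * (4 * (d : ℝ) ^ 2)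
        ≤ d * G * (j : ℝ) ^ 2 * (4 * (d : ℝ) ^ 2) := by gcongr
      _ = _ := by ring
  have hinvA' : 1 / A ≤ 1 / 4 := by
    refine hinvA.trans ?_
    rw [div_le_div_iff₀ (by positivity) (by positivity)]
    nlinarith
  have hA4 : 4 ≤ A := by
    rw [div_le_div_iff₀ hApos (by norm_num)] at hinvA'; linarith
  have hlow : A - 1 ≤ |(node d j : ℝ) - node d i| := by
    have a1 := node_le d j
    have a2 := lt_node_add_one d j hj
    have b1 := node_le d i
    have b2 := lt_node_add_one d i hi
    rw [hdiff]
    have : |4 * (d : ℝ) ^ 3 / (j : ℝ) ^ 2 - 4 * (d : ℝ) ^ 3 / (i : ℝ) ^ 2 -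
        ((node d j : ℝ) - node d i)| ≤ 1 := by
      rw [abs_le]; constructor <;> linarith
    have := abs_sub_abs_le_abs_sub (4 * (d : ℝ) ^ 3 / (j : ℝ) ^ 2 - 4 * (d : ℝ) ^ 3 / (i : ℝ) ^ 2)
      ((node d j : ℝ) - node d i)
    linarith
  refine ⟨by linarith, ?_⟩
  have hexp : A ≤ Real.exp ((j : ℝ) ^ 2 / (2 * (d : ℝ) ^ 2)) * (A - 1) := by
    have h1 : 1 + 2 / A ≤ Real.exp ((j : ℝ) ^ 2 / (2 * (d : ℝ) ^ 2)) := by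
      have h2 := Real.add_one_le_exp ((j : ℝ) ^ 2 / (2 * (d : ℝ) ^ 2))
      have h3 : 2 / A ≤ (j : ℝ) ^ 2 / (2 * (d : ℝ) ^ 2) := by
        calc 2 / A = 2 * (1 / A) := by ring
          _ ≤ 2 * ((j : ℝ) ^ 2 / (4 * (d : ℝ) ^ 2)) := by gcongr
          _ = _ := by field_simp; norm_num
      linarith
    calc A ≤ (1 + 2 / A) * (A - 1) := by
          have : (1 + 2 / A) * (A - 1) = A + 1 - 2 / A := by field_simp; ring
          rw [this]
          have : 2 / A = 2 * (1 / A) := by ring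
          linarith
      _ ≤ _ := by gcongr; linarith
  calc (node d j : ℝ) / |(node d j : ℝ) - node d i|
      ≤ (4 * (d : ℝ) ^ 3 / (j : ℝ) ^ 2) / (A - 1) := by
        gcongr
        · linarith
        · exact node_le d j
    _ ≤ (4 * (d : ℝ) ^ 3 / (j : ℝ) ^ 2) / (A / Real.exp ((j : ℝ) ^ 2 / (2 * (d : ℝ) ^ 2))) := by
        gcongr
        rw [div_le_iff₀ (Real.exp_pos _)]; linarith
    _ = _ := by
        rw [hA]
        field_simp

/-- The `d - 1` rounding factors `exp (j² / (2 d²))` multiply to at most `exp (j² / (2 d))`, which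
the decay in `prod_sq_div_le` cancels. -/
theorem prod_node_le (d j : ℕ) (hj : 1 ≤ j) (hd : j ≤ d) :
    ∏ i ∈ (Icc 1 d).erase j, (node d j : ℝ) / |(node d j : ℝ) - node d i| ≤ 2 := by
  have hd0 : (0 : ℝ) < d := by exact_mod_cast (by omega : 0 < d)
  calc ∏ i ∈ (Icc 1 d).erase j, (node d j : ℝ) / |(node d j : ℝ) - node d i|
      ≤ ∏ i ∈ (Icc 1 d).erase j, ((i : ℝ) ^ 2 / |(i : ℝ) ^ 2 - (j : ℝ) ^ 2| *
          Real.exp ((j : ℝ) ^ 2 / (2 * (d : ℝ) ^ 2))) := by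
        apply prod_le_prod
        · intro i _; positivity
        · intro i hi
          simp only [mem_erase, mem_Icc] at hi
          exact (node_factor_le d i j hi.2.1 hi.2.2 hj hd hi.1).2
    _ = (∏ i ∈ (Icc 1 d).erase j, (i : ℝ) ^ 2 / |(i : ℝ) ^ 2 - (j : ℝ) ^ 2|) *
          Real.exp ((j : ℝ) ^ 2 / (2 * (d : ℝ) ^ 2)) ^ (d - 1) := by
        rw [prod_mul_distrib, prod_const, card_erase_of_mem (by simp; omega)]; simp
    _ ≤ 2 * Real.exp (-((j : ℝ) ^ 2 / (2 * d))) * Real.exp ((j : ℝ) ^ 2 / (2 * d)) := by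
        gcongr
        · exact prod_sq_div_le d j hj hd
        · calc Real.exp ((j : ℝ) ^ 2 / (2 * (d : ℝ) ^ 2)) ^ (d - 1)
              ≤ Real.exp ((j : ℝ) ^ 2 / (2 * (d : ℝ) ^ 2)) ^ d :=
                pow_le_pow_right₀ (Real.one_le_exp (by positivity)) (by omega)
            _ = _ := by rw [← Real.exp_nat_mul]; congr 1; field_simp
    _ = 2 := by rw [mul_assoc, ← Real.exp_add]; simp

theorem sum_inv_sq_le (d : ℕ) : ∑ j ∈ Icc 1 d, 1 / (j : ℝ) ^ 2 ≤ 2 := by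
  -- telescoping comparison with `1 / (j - 1) - 1 / j`
  have h : ∀ d : ℕ, ∑ j ∈ Icc 1 (d + 1), 1 / (j : ℝ) ^ 2 ≤ 2 - 1 / ((d : ℝ) + 1) := by
    intro d
    induction d with
    | zero => norm_num
    | succ d ih =>
      rw [sum_Icc_succ_top (by omega)]
      refine (add_le_add_left ih _).trans ?_
      push_cast
      have : 1 / ((d : ℝ) + 1 + 1) ^ 2 ≤ 1 / ((d : ℝ) + 1) - 1 / ((d : ℝ) + 1 + 1) := by
        rw [div_sub_div _ _ (by positivity) (by positivity),
          div_le_div_iff₀ (by positivity) (by positivity)]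
        nlinarith [Nat.cast_nonneg (α := ℝ) d]
      linarith
  rcases d with _ | d
  · simp
  · exact (h d).trans (by linarith [show (0 : ℝ) ≤ 1 / ((d : ℝ) + 1) by positivity])

/-- A polynomial of degree at most `d` that varies by at most `1` on the points `1 / s`, `1 ≤ s ≤ r`,
changes by `O(d³ / r)` between `1 / r` and `0`. The value at `0` is obtained by Lagrange interpolation
at `1 / r` and the points `1 / node d j`, `1 ≤ j ≤ d`; the weight of `1 / node d j` is
`O(node d j / r) = O(d³ / (j² r))`. -/
theorem norm_eval_zero_sub_le (d r : ℕ) (hr : 8 * d ^ 3 ≤ r) (hr1 : 1 ≤ r) (P : ℂ[X])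
    (hP : P.degree ≤ d)
    (hb : ∀ s : ℕ, 1 ≤ s → s ≤ r → ‖P.eval (s : ℂ)⁻¹ - P.eval (r : ℂ)⁻¹‖ ≤ 1) :
    ‖P.eval 0 - P.eval (r : ℂ)⁻¹‖ ≤ 32 * (d : ℝ) ^ 3 / r := by
  -- the index `0` stands for the node `r`
  set a : ℕ → ℕ := fun j => if j = 0 then r else node d j with ha
  have ha0 : a 0 = r := by simp [ha]
  have haj : ∀ j, 1 ≤ j → a j = node d j := fun j hj => by simp [ha]; omega
  have hnode_half : ∀ j, 1 ≤ j → 2 * (node d j : ℝ) ≤ r := by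
    intro j hj
    have h1 : node d j ≤ 4 * d ^ 3 := Nat.div_le_self _ _
    have : 2 * node d j ≤ r := by omega
    exact_mod_cast this
  have hpos : ∀ j ∈ range (d + 1), 1 ≤ a j := by
    intro j hj
    rcases Nat.eq_zero_or_pos j with rfl | h
    · rw [ha0]; exact hr1
    · rw [haj j h]; exact one_le_node d j h (by simp at hj; omega)
  have hler : ∀ j ∈ range (d + 1), a j ≤ r := by
    intro j hj
    rcases Nat.eq_zero_or_pos j with rfl | h
    · rw [ha0]
    · rw [haj j h]
      have := hnode_half j h
      have h3 : (node d j : ℝ) ≤ r := by linarith [Nat.cast_nonneg (α := ℝ) (node d j)]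
      exact_mod_cast h3
  have hinj : Set.InjOn a (range (d + 1) : Set ℕ) := by
    intro i hi j hj hij
    by_contra hne
    simp only [coe_range, Set.mem_Iio] at hi hj
    have h0 : ∀ j, 1 ≤ j → j < d + 1 → a j ≠ a 0 := by
      intro j hj hjd h
      have h1 := hnode_half j hj
      have h2 : 1 ≤ node d j := one_le_node d j hj (by omega)
      rw [haj j hj, ha0] at h
      rw [← h] at h1
      have : (1 : ℝ) ≤ node d j := by exact_mod_cast h2
      linarith
    rcases Nat.eq_zero_or_pos i with rfl | hi0
    · exact h0 j (by omega) hj hij.symm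
    · rcases Nat.eq_zero_or_pos j with rfl | hj0
      · exact h0 i hi0 hi hij
      · have := (node_factor_le d i j hi0 (by omega) hj0 (by omega) hne).1
        rw [haj i hi0, haj j hj0] at hij
        simp [hij] at this
  set v : ℕ → ℂ := fun j => (a j : ℂ)⁻¹ with hv
  have hvinj : Set.InjOn v (range (d + 1) : Set ℕ) := by
    intro i hi j hj hij
    apply hinj hi hj
    have := inv_injective hij
    exact_mod_cast this
  have hint := Lagrange.eq_interpolate (f := P) hvinj (by
    rw [card_range]; exact lt_of_le_of_lt hP (by exact_mod_cast Nat.lt_succ_self d))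
  have hone := Lagrange.sum_basis hvinj (by simp)
  have hsum : P.eval 0 - P.eval (r : ℂ)⁻¹ = ∑ j ∈ range (d + 1),
      (P.eval (v j) - P.eval (r : ℂ)⁻¹) * (Lagrange.basis (range (d + 1)) v j).eval 0 := by
    have h1 : (∑ j ∈ range (d + 1), Lagrange.basis (range (d + 1)) v j).eval (0 : ℂ) = 1 := by
      rw [hone]; simp
    have h2 : P.eval 0 = ∑ j ∈ range (d + 1),
        P.eval (v j) * (Lagrange.basis (range (d + 1)) v j).eval 0 := by
      conv_lhs => rw [hint]
      rw [Lagrange.interpolate_apply, eval_finsetSum]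
      simp
    rw [eval_finsetSum] at h1
    simp only [sub_mul, sum_sub_distrib, ← h2, ← mul_sum, h1, mul_one]
  have hv0 : v 0 = (r : ℂ)⁻¹ := by simp [hv, ha0]
  rw [hsum, range_eq_Ico, sum_eq_sum_Ico_succ_bot (by omega), hv0, sub_self, zero_mul, zero_add,
    ← range_eq_Ico]
  have hIco : Ico (0 + 1) (d + 1) = Icc 1 d := by ext i; simp
  rw [hIco]
  have hbasis : ∀ j ∈ Icc 1 d, ‖(Lagrange.basis (range (d + 1)) v j).eval 0‖ ≤
      16 * (d : ℝ) ^ 3 / r * (1 / (j : ℝ) ^ 2) := by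
    intro j hj
    rw [mem_Icc] at hj
    have hj0 : (0 : ℝ) < j := by exact_mod_cast hj.1
    have hr0 : (0 : ℝ) < r := by exact_mod_cast hr1
    have hfac : ∀ i ∈ (range (d + 1)).erase j,
        ‖(Lagrange.basisDivisor (v j) (v i)).eval 0‖ = (a j : ℝ) / |(a j : ℝ) - a i| := by
      intro i hi
      rw [mem_erase] at hi
      have hai : (a i : ℂ) ≠ 0 := by exact_mod_cast (by have := hpos i hi.2; omega : a i ≠ 0)
      have haj' : (a j : ℂ) ≠ 0 := by
        exact_mod_cast (by have := hpos j (by simp; omega); omega : a j ≠ 0)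
      have hne : (a i : ℂ) - a j ≠ 0 := by
        rw [sub_ne_zero]
        intro h
        exact hi.1 (hinj hi.2 (by simp; omega) (by exact_mod_cast h))
      have hne' : (a j : ℂ) - a i ≠ 0 := by rw [← neg_sub]; exact neg_ne_zero.mpr hne
      have : (Lagrange.basisDivisor (v j) (v i)).eval 0 = (a j : ℂ) / ((a j : ℂ) - a i) := by
        simp only [Lagrange.basisDivisor, eval_mul, eval_C, eval_sub, eval_X, hv]
        have : (a j : ℂ)⁻¹ - (a i : ℂ)⁻¹ = (a i - a j) / (a j * a i) := by field_simp
        rw [this]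
        field_simp
        ring
      rw [this, norm_div, Complex.norm_natCast]
      congr 1
      rw [show (a j : ℂ) - a i = (((a j : ℝ) - a i : ℝ) : ℂ) by push_cast; rfl, Complex.norm_real,
        Real.norm_eq_abs]
    rw [Lagrange.basis, eval_prod, norm_prod, prod_congr rfl hfac]
    have e : (range (d + 1)).erase j = insert 0 ((Icc 1 d).erase j) := by
      ext i; simp only [mem_erase, mem_range, mem_insert, mem_Icc]; omega
    rw [e, prod_insert (by simp), ha0, haj j hj.1]
    have hprod : ∏ i ∈ (Icc 1 d).erase j, (node d j : ℝ) / |(node d j : ℝ) - a i| ≤ 2 := by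
      refine le_trans (le_of_eq (prod_congr rfl ?_)) (prod_node_le d j hj.1 hj.2)
      intro i hi
      simp only [mem_erase, mem_Icc] at hi
      rw [haj i hi.2.1]
    have hhalf := hnode_half j hj.1
    have hfirst : (node d j : ℝ) / |(node d j : ℝ) - r| ≤ 8 * (d : ℝ) ^ 3 / r * (1 / (j : ℝ) ^ 2) := by
      have h1 : (r : ℝ) / 2 ≤ |(node d j : ℝ) - r| := by
        rw [abs_sub_comm]
        exact le_trans (by linarith) (le_abs_self _)
      calc (node d j : ℝ) / |(node d j : ℝ) - r| ≤ (4 * (d : ℝ) ^ 3 / (j : ℝ) ^ 2) / ((r : ℝ) / 2) := by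
            gcongr; exact node_le d j
        _ = _ := by field_simp; ring
    calc _ ≤ 8 * (d : ℝ) ^ 3 / r * (1 / (j : ℝ) ^ 2) * 2 := by gcongr
      _ = _ := by ring
  calc _ ≤ ∑ j ∈ Icc 1 d, ‖(P.eval (v j) - P.eval (r : ℂ)⁻¹) *
        (Lagrange.basis (range (d + 1)) v j).eval 0‖ := norm_sum_le _ _
    _ ≤ ∑ j ∈ Icc 1 d, 16 * (d : ℝ) ^ 3 / r * (1 / (j : ℝ) ^ 2) := by
        apply sum_le_sum
        intro j hj
        rw [norm_mul]
        have hjr : j ∈ range (d + 1) := by rw [mem_Icc] at hj; simp; omega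
        have h1 := hb (a j) (hpos j hjr) (hler j hjr)
        calc _ ≤ 1 * ‖(Lagrange.basis (range (d + 1)) v j).eval 0‖ := by gcongr
          _ ≤ _ := by rw [one_mul]; exact hbasis j hj
    _ = 16 * (d : ℝ) ^ 3 / r * ∑ j ∈ Icc 1 d, 1 / (j : ℝ) ^ 2 := by rw [mul_sum]
    _ ≤ 16 * (d : ℝ) ^ 3 / r * 2 := by gcongr; exact sum_inv_sq_le d
    _ = _ := by ring

end QueryComplexity
end

/-! ### The polynomial method for random permutations and small-range functions -/

noncomputable section

namespace QueryComplexity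

open Finset Polynomial
open scoped Nat BigOperators Matrix

/-- A uniformly random injection, restricted to `d` distinct points, is a uniformly random injection
of these `d` points. -/
theorem expect_embedding_comp_eq {r n d : ℕ} (k : Fin d ↪ Fin r) (u : Fin d ↪ Fin n)
    (hrn : r ≤ n) :
    (𝔼 h : Fin r ↪ Fin n, if k.trans h = u then (1 : ℂ) else 0) = 1 / (n.descFactorial d : ℂ) := by
  have : Nonempty (Fin r ↪ Fin n) := ⟨Fin.castLEEmb hrn⟩
  -- by symmetry under permutations of `[n]`, the expectation does not depend on `u`
  have hsymm : ∀ w : Fin d ↪ Fin n,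
      (𝔼 h : Fin r ↪ Fin n, if k.trans h = w then (1 : ℂ) else 0) =
        𝔼 h : Fin r ↪ Fin n, if k.trans h = u then (1 : ℂ) else 0 := by
    intro w
    have := Equiv.Perm.isMultiplyPretransitive (Fin n) d
    obtain ⟨σ, hσ⟩ := MulAction.exists_smul_eq (Equiv.Perm (Fin n)) w u
    refine Fintype.expect_equiv (Equiv.embeddingCongr (Equiv.refl _) σ) _ _ ?_
    intro h
    have : k.trans h = w ↔ k.trans (Equiv.embeddingCongr (Equiv.refl _) σ h) = u := by
      rw [← hσ]
      simp only [Function.Embedding.ext_iff]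
      simp
    simp only [this]
  have hsum : ∑ w : Fin d ↪ Fin n,
      (𝔼 h : Fin r ↪ Fin n, if k.trans h = w then (1 : ℂ) else 0) = 1 := by
    rw [← expect_sum_comm]
    simp
  simp only [hsymm, sum_const, nsmul_eq_mul] at hsum
  rw [card_univ, Fintype.card_embedding_eq, Fintype.card_fin, Fintype.card_fin] at hsum
  exact eq_one_div_of_mul_eq_one_right hsum

theorem expect_perm_comp_eq {n d : ℕ} (k u : Fin d ↪ Fin n) :
    (𝔼 π : Equiv.Perm (Fin n), if ∀ i, π (k i) = u i then (1 : ℂ) else 0) =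
      1 / (n.descFactorial d : ℂ) := by
  rw [← expect_embedding_comp_eq k u le_rfl]
  refine (Fintype.expect_equiv (Equiv.embeddingEquivOfFinite (Fin n)) _ _ ?_).symm
  intro h
  simp [Function.Embedding.ext_iff, Equiv.embeddingEquivOfFinite,
    Function.Embedding.equivOfFiniteSelfEmbedding]

/-- The range of a uniformly random injection contains a given set of `d` points with probability
`(r)_d / (n)_d`, where `(r)_d` is the falling factorial. -/
theorem expect_subset_range {r n : ℕ} (Y : Finset (Fin n)) (hrn : r ≤ n) :
    (𝔼 h : Fin r ↪ Fin n, if ∀ y ∈ Y, y ∈ Set.range h then (1 : ℂ) else 0) =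
      (r.descFactorial #Y : ℂ) / (n.descFactorial #Y : ℂ) := by
  classical
  set u : Fin #Y ↪ Fin n := (Y.orderEmbOfFin rfl).toEmbedding with hu
  have hY : ∀ y, y ∈ Y ↔ ∃ i, u i = y := by
    intro y
    have := Finset.range_orderEmbOfFin Y rfl
    rw [Set.ext_iff] at this
    simpa only [hu, Set.mem_range, mem_coe, RelEmbedding.coe_toEmbedding] using (this y).symm
  -- an injection whose range contains `Y` pulls the enumeration `u` of `Y` back uniquely
  have hcount : ∀ h : Fin r ↪ Fin n, (if ∀ y ∈ Y, y ∈ Set.range h then (1 : ℂ) else 0) =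
      ∑ k : Fin #Y ↪ Fin r, if k.trans h = u then (1 : ℂ) else 0 := by
    intro h
    split_ifs with hr
    · have hr' : ∀ i, ∃ a, h a = u i := fun i => hr (u i) ((hY _).2 ⟨i, rfl⟩)
      choose k hk using hr'
      have kinj : Function.Injective k := fun i j hij => u.injective (by rw [← hk, ← hk, hij])
      rw [sum_eq_single (⟨k, kinj⟩ : Fin #Y ↪ Fin r)]
      · rw [if_pos]; ext i; simp [hk]
      · intro k' _ hne
        rw [if_neg]
        intro hk'
        apply hne
        ext i
        congr 1
        apply h.injective
        have := DFunLike.congr_fun hk' i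
        simpa [hk] using this
      · simp
    · symm
      apply sum_eq_zero
      intro k _
      rw [if_neg]
      intro hk
      apply hr
      intro y hy
      obtain ⟨i, rfl⟩ := (hY y).1 hy
      exact ⟨k i, DFunLike.congr_fun hk i⟩
  simp only [hcount]
  rw [expect_sum_comm, sum_congr rfl (fun k _ => expect_embedding_comp_eq k u hrn)]
  rw [sum_const, card_univ, Fintype.card_embedding_eq, Fintype.card_fin, Fintype.card_fin,
    nsmul_eq_mul, mul_one_div]

/-- The indicator function of the event that `C p.1 = p.2` for all `p ∈ s`. -/
def constraintIndicator {n : ℕ} (s : Finset (Fin n × Fin n)) (C : Fin n → Fin n) : ℂ :=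
  if ∀ p ∈ s, C p.1 = p.2 then 1 else 0

/-- Only the inner function `g` is random here. Its values are independent, and each constraint
`h (g i) = y` has probability `1 / r` if `y` is in the range of the injection `h`, and `0` otherwise. -/
theorem expect_constraintIndicator_comp {r n : ℕ} (s : Finset (Fin n × Fin n))
    (hs : Set.InjOn Prod.fst (s : Set (Fin n × Fin n))) (hr : 1 ≤ r) (h : Fin r ↪ Fin n) :
    (𝔼 g : Fin n → Fin r, constraintIndicator s (h ∘ g)) =
      (r : ℂ)⁻¹ ^ #s * if ∀ y ∈ s.image Prod.snd, y ∈ Set.range h then (1 : ℂ) else 0 := by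
  classical
  have hr0 : (r : ℂ) ≠ 0 := by exact_mod_cast (by omega : r ≠ 0)
  set ind : Fin n → Fin r → ℂ := fun x a => if ∀ p ∈ s, p.1 = x → h a = p.2 then 1 else 0 with hind
  have hprod : ∀ g : Fin n → Fin r, constraintIndicator s (h ∘ g) = ∏ x, ind x (g x) := by
    intro g
    simp only [constraintIndicator, hind, prod_boole]
    congr 1
    apply propext
    constructor
    · rintro H x - p hp rfl
      exact H p hp
    · intro H p hp
      exact H p.1 (mem_univ _) p hp rfl
  have hfac : ∀ x, ∑ a, ind x a = if x ∈ s.image Prod.fst then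
      (if ∀ p ∈ s, p.1 = x → p.2 ∈ Set.range h then (1 : ℂ) else 0) else r := by
    intro x
    by_cases hx : x ∈ s.image Prod.fst
    · rw [if_pos hx]
      obtain ⟨p, hp, rfl⟩ := mem_image.1 hx
      have huniq : ∀ q ∈ s, q.1 = p.1 → q = p := fun q hq h => hs hq hp h
      have e1 : ∀ a, ind p.1 a = if h a = p.2 then 1 else 0 := by
        intro a
        simp only [hind]
        congr 1
        apply propext
        exact ⟨fun H => H p hp rfl, fun H q hq hqp => by rw [huniq q hq hqp, H]⟩
      simp only [e1]
      by_cases hr : ∃ a, h a = p.2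
      · rw [if_pos (fun q hq hqp => by rw [huniq q hq hqp]; exact hr)]
        obtain ⟨a, ha⟩ := hr
        rw [sum_eq_single a]
        · rw [if_pos ha]
        · intro b _ hb
          rw [if_neg]
          intro h'
          exact hb (h.injective (h'.trans ha.symm))
        · simp
      · rw [if_neg (fun H => hr (H p hp rfl))]
        apply sum_eq_zero
        intro a _
        rw [if_neg (fun h' => hr ⟨a, h'⟩)]
    · rw [if_neg hx]
      have e1 : ∀ a, ind x a = 1 := by
        intro a
        simp only [hind]
        rw [if_pos]
        rintro p hp rfl
        exact absurd (mem_image_of_mem _ hp) hx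
      simp [e1]
  have hcard : #(s.image Prod.fst) = #s := card_image_of_injOn hs
  have hle : #s ≤ n := by rw [← hcard]; simpa using card_le_univ (s.image Prod.fst)
  rw [Fintype.expect_eq_sum_div_card]
  simp only [hprod]
  rw [← Fintype.piFinset_univ, sum_prod_piFinset, prod_congr rfl (fun x _ => hfac x), prod_ite]
  have hf : univ.filter (fun x => x ∈ s.image Prod.fst) = s.image Prod.fst := by ext; simp
  have hnf : #(univ.filter (fun x => x ∉ s.image Prod.fst)) = n - #s := by
    rw [filter_not, hf, ← compl_eq_univ_sdiff, card_compl, hcard, Fintype.card_fin]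
  rw [hf, prod_const, hnf, prod_boole]
  have hiff : (∀ x ∈ s.image Prod.fst, ∀ p ∈ s, p.1 = x → p.2 ∈ Set.range h) ↔
      ∀ y ∈ s.image Prod.snd, y ∈ Set.range h := by
    constructor
    · intro H y hy
      obtain ⟨p, hp, rfl⟩ := mem_image.1 hy
      exact H p.1 (mem_image_of_mem _ hp) p hp rfl
    · intro H x _ p hp _
      exact H p.2 (mem_image_of_mem _ hp)
  simp only [hiff]
  rw [Fintype.card_fun, Fintype.card_fin, Fintype.card_fin]
  obtain ⟨m, hm⟩ : ∃ m, n = #s + m := ⟨n - #s, by omega⟩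
  have : n - #s = m := by omega
  rw [this]
  have hpow : ((r ^ n : ℕ) : ℂ) = (r : ℂ) ^ #s * (r : ℂ) ^ m := by
    rw [← pow_add, ← hm]; push_cast; rfl
  rw [hpow, inv_pow]
  field_simp

/-- The quotient `(r)_d / r ^ t` is a polynomial in `1 / r`. -/
theorem eval_inv_falling (r t d : ℕ) (hr : 1 ≤ r) (hd : d ≤ t) :
    ((X : ℂ[X]) ^ (t - d) * ∏ i ∈ range d, (1 - C (i : ℂ) * X)).eval (r : ℂ)⁻¹ =
      (r : ℂ)⁻¹ ^ t * r.descFactorial d := by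
  have hr0 : (r : ℂ) ≠ 0 := by exact_mod_cast (by omega : r ≠ 0)
  rw [← descPochhammer_eval_eq_descFactorial, descPochhammer_eval_eq_prod_range]
  simp only [eval_mul, eval_pow, eval_X, eval_prod, eval_sub, eval_one, eval_C]
  obtain ⟨m, rfl⟩ : ∃ m, t = d + m := ⟨t - d, by omega⟩
  have e : ∀ i ∈ range d, (1 - (i : ℂ) * (r : ℂ)⁻¹) = (r : ℂ)⁻¹ * ((r : ℂ) - i) := by
    intro i _; field_simp
  rw [prod_congr rfl e, prod_mul_distrib, prod_const, card_range, Nat.add_sub_cancel_left, pow_add]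
  ring

theorem degree_falling_le (t d : ℕ) (hd : d ≤ t) :
    ((X : ℂ[X]) ^ (t - d) * ∏ i ∈ range d, (1 - C (i : ℂ) * X)).degree ≤ t := by
  apply degree_le_of_natDegree_le
  refine natDegree_mul_le.trans ?_
  have h1 : (∏ i ∈ range d, (1 - C (i : ℂ) * X)).natDegree ≤ d := by
    refine (natDegree_prod_le _ _).trans ?_
    refine (sum_le_card_nsmul _ _ 1 ?_).trans (by simp)
    intro i _
    refine (natDegree_sub_le _ _).trans ?_
    simpa using natDegree_C_mul_le (i : ℂ) X
  rw [natDegree_X_pow]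
  omega

/-- One polynomial of degree at most `k` gives the expectation of `F` at a small-range function
with parameter `r` as its value at `1 / r`, for all `1 ≤ r ≤ n`, and the expectation of `F` at a random
permutation as its value at `0`. -/
def IsInterpolated {n : ℕ} (k : ℕ) (F : (Fin n → Fin n) → ℂ) : Prop :=
  ∃ P : ℂ[X], P.degree ≤ k ∧
    (∀ r : ℕ, 1 ≤ r → r ≤ n →
      (𝔼 g : Fin n → Fin r, 𝔼 h : Fin r ↪ Fin n, F (h ∘ g)) = P.eval (r : ℂ)⁻¹) ∧
    (𝔼 π : Equiv.Perm (Fin n), F π) = P.eval 0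

theorem degree_C_mul_le_degree (a : ℂ) (P : ℂ[X]) : (C a * P).degree ≤ P.degree :=
  (degree_mul_le _ _).trans (by simpa using add_le_add_left degree_C_le P.degree)

/-- If the constraints involve `#s` positions and `d` values, the polynomial in `1 / r` is
`(r)_d / ((n)_d r ^ #s)`. At `0` it is `1 / (n)_d` if `d = #s` and `0` if `d < #s`, which is the
probability that a permutation satisfies the constraints. -/
theorem isInterpolated_constraintIndicator {n : ℕ} (s : Finset (Fin n × Fin n)) :
    IsInterpolated #s (constraintIndicator s) := by
  classical
  -- constraints that give one position two values are never satisfied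
  by_cases hs : Set.InjOn Prod.fst (s : Set (Fin n × Fin n))
  swap
  · have h0 : constraintIndicator s = 0 := by
      funext C
      rw [constraintIndicator, if_neg]
      · rfl
      intro H
      apply hs
      intro p hp q hq hpq
      exact Prod.ext hpq (by rw [← H p hp, ← H q hq, hpq])
    exact ⟨0, by simp, by simp [h0], by simp [h0]⟩
  set d := #(s.image Prod.snd) with hd
  have hds : d ≤ #s := card_image_le
  refine ⟨C (1 / (n.descFactorial d : ℂ)) *
    (X ^ (#s - d) * ∏ i ∈ range d, (1 - C (i : ℂ) * X)), ?_, ?_, ?_⟩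
  · exact (degree_C_mul_le_degree _ _).trans (degree_falling_le _ _ hds)
  · intro r hr hrn
    rw [expect_comm, expect_congr rfl (fun h _ => expect_constraintIndicator_comp s hs hr h),
      ← mul_expect, expect_subset_range _ hrn, eval_mul, eval_C, eval_inv_falling r _ _ hr hds]
    ring
  · rcases hds.eq_or_lt with heq | hlt
    · have hinj : Set.InjOn Prod.snd (s : Set (Fin n × Fin n)) := card_image_iff.1 heq
      have e : Fin d ≃ s := (finCongr heq).trans s.equivFin.symm
      let k : Fin d ↪ Fin n := ⟨fun i => (e i).1.1, fun i j hij =>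
        e.injective (Subtype.ext (hs (e i).2 (e j).2 hij))⟩
      let u : Fin d ↪ Fin n := ⟨fun i => (e i).1.2, fun i j hij =>
        e.injective (Subtype.ext (hinj (e i).2 (e j).2 hij))⟩
      have h1 : ∀ π : Equiv.Perm (Fin n), constraintIndicator s π =
          if ∀ i, π (k i) = u i then (1 : ℂ) else 0 := by
        intro π
        rw [constraintIndicator]
        congr 1
        apply propext
        constructor
        · intro H i
          exact H _ (e i).2
        · intro H p hp
          have h := H (e.symm ⟨p, hp⟩)
          change π (e (e.symm ⟨p, hp⟩)).1.1 = (e (e.symm ⟨p, hp⟩)).1.2 at h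
          rwa [e.apply_symm_apply] at h
      simp only [h1]
      rw [expect_perm_comp_eq k u, ← heq]
      simp [eval_prod]
    · have h0 : ∀ π : Equiv.Perm (Fin n), constraintIndicator s π = 0 := by
        intro π
        rw [constraintIndicator, if_neg]
        intro H
        apply hlt.ne
        apply card_image_of_injOn
        intro p hp q hq hpq
        exact Prod.ext (π.injective (by rw [H p hp, H q hq, hpq])) hpq
      have : #s - d ≠ 0 := by omega
      simp [h0, this]

/-- The functionals that are polynomials of degree at most `k` in the indicators of `C i = y`. -/
def constraintSpan (n k : ℕ) : Submodule ℂ ((Fin n → Fin n) → ℂ) :=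
  Submodule.span ℂ {F | ∃ s : Finset (Fin n × Fin n), #s ≤ k ∧ F = constraintIndicator s}

theorem IsInterpolated.of_mem_constraintSpan {n k : ℕ} {F : (Fin n → Fin n) → ℂ}
    (hF : F ∈ constraintSpan n k) : IsInterpolated k F := by
  induction hF using Submodule.span_induction with
  | mem F hF =>
    obtain ⟨s, hs, rfl⟩ := hF
    obtain ⟨P, h1, h2, h3⟩ := isInterpolated_constraintIndicator s
    exact ⟨P, h1.trans (by exact_mod_cast hs), h2, h3⟩
  | zero => exact ⟨0, by simp, by simp, by simp⟩
  | add F G _ _ hF hG =>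
    obtain ⟨P, h1, h2, h3⟩ := hF
    obtain ⟨P', h1', h2', h3'⟩ := hG
    refine ⟨P + P', (degree_add_le _ _).trans (max_le h1 h1'), fun r hr hrn => ?_, ?_⟩
    · simp only [Pi.add_apply, expect_add_distrib, eval_add, h2 r hr hrn, h2' r hr hrn]
    · simp only [Pi.add_apply, expect_add_distrib, eval_add, h3, h3']
  | smul a F _ hF =>
    obtain ⟨P, h1, h2, h3⟩ := hF
    refine ⟨C a * P, (degree_C_mul_le_degree _ _).trans h1, fun r hr hrn => ?_, ?_⟩
    · simp only [Pi.smul_apply, smul_eq_mul, ← mul_expect, eval_mul, eval_C, h2 r hr hrn]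
    · simp only [Pi.smul_apply, smul_eq_mul, ← mul_expect, eval_mul, eval_C, h3]

theorem mul_mem_constraintSpan {n k l : ℕ} {F G : (Fin n → Fin n) → ℂ}
    (hF : F ∈ constraintSpan n k) (hG : G ∈ constraintSpan n l) :
    F * G ∈ constraintSpan n (k + l) := by
  classical
  have h := Submodule.mul_mem_mul hF hG
  rw [constraintSpan, constraintSpan, Submodule.span_mul_span] at h
  refine Submodule.span_mono ?_ h
  rintro _ ⟨_, ⟨s, hs, rfl⟩, _, ⟨t, ht, rfl⟩, rfl⟩
  refine ⟨s ∪ t, (card_union_le _ _).trans (add_le_add hs ht), ?_⟩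
  funext C
  have e : (∀ p ∈ s ∪ t, C p.1 = p.2) ↔ (∀ p ∈ s, C p.1 = p.2) ∧ ∀ p ∈ t, C p.1 = p.2 := by
    simp only [mem_union, or_imp, forall_and]
  simp only [constraintIndicator, e, Pi.mul_apply, ite_and, mul_ite, mul_one, mul_zero]
  split_ifs <;> rfl

theorem star_mem_constraintSpan {n k : ℕ} {F : (Fin n → Fin n) → ℂ}
    (hF : F ∈ constraintSpan n k) : star F ∈ constraintSpan n k := by
  induction hF using Submodule.span_induction with
  | mem F hF =>
    obtain ⟨s, hs, rfl⟩ := hF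
    apply Submodule.subset_span
    refine ⟨s, hs, ?_⟩
    funext C
    simp only [constraintIndicator, Pi.star_apply]
    split_ifs <;> simp
  | zero => simp
  | add F G _ _ hF hG => rw [star_add]; exact add_mem hF hG
  | smul a F _ hF => rw [star_smul]; exact Submodule.smul_mem _ _ hF

theorem const_mem_constraintSpan {n k : ℕ} (a : ℂ) :
    (fun _ => a) ∈ constraintSpan n k := by
  have h : constraintIndicator ∅ ∈ constraintSpan n k :=
    Submodule.subset_span ⟨∅, by simp, rfl⟩
  have := Submodule.smul_mem _ a h
  convert this using 1
  funext C
  simp [constraintIndicator]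

theorem oracle_apply_mem_constraintSpan {n w : ℕ} (b' b : QBasis n n w) :
    (fun C => oracle w C b' b) ∈ constraintSpan n 1 := by
  have h : (fun C => oracle w C b' b) = ∑ y : Fin n,
      (if b' = (b.1, b.2.1 + y, b.2.2) then (1 : ℂ) else 0) • constraintIndicator {(b.1, y)} := by
    funext C
    simp only [oracle, constraintIndicator, Matrix.of_apply, Finset.sum_apply, Pi.smul_apply,
      smul_eq_mul, mem_singleton, forall_eq, mul_ite, mul_one, mul_zero, sum_ite_eq, mem_univ,
      if_true]
  rw [h]
  exact sum_mem fun y _ => Submodule.smul_mem _ _ (Submodule.subset_span ⟨_, by simp, rfl⟩)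

/-- Each query raises the degree of the amplitudes by at most one. -/
theorem QuantumAlgorithm.state_mem_constraintSpan {n : ℕ} (A : QuantumAlgorithm n n) (k : ℕ)
    (v : QBasis n n A.workDim) : (fun C => A.state C k v) ∈ constraintSpan n k := by
  induction k generalizing v with
  | zero => exact const_mem_constraintSpan _
  | succ k ih =>
    have h : (fun C => A.state C (k + 1) v) = ∑ b', (A.U (k + 1)).1 v b' •
        ∑ b, (fun C => oracle A.workDim C b' b) * (fun C => A.state C k b) := by
      funext C
      simp [QuantumAlgorithm.state, Matrix.mulVec, dotProduct, Finset.sum_apply]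
    rw [h]
    refine sum_mem fun b' _ => Submodule.smul_mem _ _ (sum_mem fun b _ => ?_)
    rw [add_comm k 1]
    exact mul_mem_constraintSpan (oracle_apply_mem_constraintSpan b' b) (ih b)

theorem QuantumAlgorithm.prob_mem_constraintSpan {n : ℕ} (A : QuantumAlgorithm n n) (b : Bool) :
    (fun C => (A.prob C b : ℂ)) ∈ constraintSpan n (2 * A.queries) := by
  have h : (fun C => (A.prob C b : ℂ)) = ∑ v with A.out v = b,
      (fun C => A.state C A.queries v) * star (fun C => A.state C A.queries v) := by
    funext C
    simp only [QuantumAlgorithm.prob, Finset.sum_apply, Pi.mul_apply, Pi.star_apply]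
    push_cast
    exact sum_congr rfl fun v _ => (Complex.mul_conj' _).symm
  rw [h, two_mul]
  exact sum_mem fun v _ => mul_mem_constraintSpan (A.state_mem_constraintSpan _ v)
    (star_mem_constraintSpan (A.state_mem_constraintSpan _ v))

theorem sum_norm_sq_mulVec {ι : Type*} [Fintype ι] [DecidableEq ι]
    (U : Matrix.unitaryGroup ι ℂ) (ψ : ι → ℂ) :
    ∑ v, ‖(U.1 *ᵥ ψ) v‖ ^ 2 = ∑ v, ‖ψ v‖ ^ 2 := by
  have h : ∀ χ : ι → ℂ, ((∑ v, ‖χ v‖ ^ 2 : ℝ) : ℂ) = star χ ⬝ᵥ χ := by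
    intro χ
    rw [dotProduct]
    push_cast
    exact sum_congr rfl fun v _ => (Complex.conj_mul' (χ v)).symm
  apply Complex.ofReal_injective
  rw [h, h, Matrix.star_mulVec, Matrix.dotProduct_mulVec, Matrix.vecMul_vecMul,
    ← Matrix.star_eq_conjTranspose, Matrix.UnitaryGroup.star_mul_self, Matrix.vecMul_one]

theorem oracle_mulVec {n M w : ℕ} (x : Fin n → Fin M) (ψ : QBasis n M w → ℂ) (b : QBasis n M w) :
    (oracle w x *ᵥ ψ) b = ψ (b.1, b.2.1 - x b.1, b.2.2) := by
  have : NeZero M := ⟨by have := b.2.1.pos; omega⟩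
  rw [Matrix.mulVec, dotProduct, sum_eq_single (b.1, b.2.1 - x b.1, b.2.2)]
  · simp [oracle]
  · rintro c - hc
    simp only [oracle, Matrix.of_apply]
    rw [if_neg, zero_mul]
    rintro rfl
    simp at hc
  · simp

theorem QuantumAlgorithm.sum_norm_sq_state {n M : ℕ} (A : QuantumAlgorithm n M)
    (x : Fin n → Fin M) (k : ℕ) : ∑ v, ‖A.state x k v‖ ^ 2 = 1 := by
  have : NeZero M := ⟨by have := A.start.2.1.pos; omega⟩
  induction k with
  | zero =>
    rw [QuantumAlgorithm.state, sum_norm_sq_mulVec, sum_eq_single A.start]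
    · simp
    · intro v _ hv; simp [hv]
    · simp
  | succ k ih =>
    rw [QuantumAlgorithm.state, sum_norm_sq_mulVec, ← ih]
    simp only [oracle_mulVec]
    let e : QBasis n M A.workDim ≃ QBasis n M A.workDim :=
      { toFun := fun b => (b.1, b.2.1 - x b.1, b.2.2)
        invFun := fun b => (b.1, b.2.1 + x b.1, b.2.2)
        left_inv := fun b => by simp
        right_inv := fun b => by simp }
    exact Equiv.sum_comp e fun b => ‖A.state x k b‖ ^ 2

theorem QuantumAlgorithm.prob_nonneg {n M : ℕ} (A : QuantumAlgorithm n M) (x : Fin n → Fin M)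
    (b : Bool) : 0 ≤ A.prob x b := sum_nonneg fun _ _ => by positivity

theorem QuantumAlgorithm.prob_add_prob_not {n M : ℕ} (A : QuantumAlgorithm n M)
    (x : Fin n → Fin M) (b : Bool) : A.prob x b + A.prob x (!b) = 1 := by
  rw [← A.sum_norm_sq_state x A.queries, ← sum_filter_add_sum_filter_not univ (A.out · = b)]
  simp only [QuantumAlgorithm.prob]
  congr 2
  ext v
  simp only [mem_filter]
  cases A.out v <;> cases b <;> simp

theorem QuantumAlgorithm.prob_le_one {n M : ℕ} (A : QuantumAlgorithm n M) (x : Fin n → Fin M)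
    (b : Bool) : A.prob x b ≤ 1 := by
  linarith [A.prob_add_prob_not x b, A.prob_nonneg x (!b)]

theorem expectSmallRange_nonneg {n r : ℕ} {F : (Fin n → Fin n) → ℝ} (hF : ∀ C, 0 ≤ F C) :
    0 ≤ expectSmallRange n r F :=
  expect_nonneg fun _ _ => expect_nonneg fun _ _ => hF _

theorem expectSmallRange_le_one {n r : ℕ} (hr : 1 ≤ r) (hrn : r ≤ n) {F : (Fin n → Fin n) → ℝ}
    (hF : ∀ C, F C ≤ 1) : expectSmallRange n r F ≤ 1 := by
  have : Nonempty (Fin r ↪ Fin n) := ⟨Fin.castLEEmb hrn⟩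
  have : Nonempty (Fin r) := ⟨⟨0, hr⟩⟩
  exact expect_le univ_nonempty fun _ _ => expect_le univ_nonempty fun _ _ => hF _

/-- Acceptance probabilities are interpolated by a polynomial of degree `2 q`, so the advantage is at
most `32 (2 q)³ / r = 256 q³ / r`, and `q ≤ r ^ (1/3) / 16` makes this at most `1 / 16 ≤ 2 / 27`. -/
theorem isZhandryConstant_one_div_sixteen : IsZhandryConstant (1 / 16) := by
  refine ⟨by norm_num, fun n r hr hrn B hq b => ?_⟩
  obtain ⟨P, hdeg, hsmall, hperm⟩ :=
    IsInterpolated.of_mem_constraintSpan (B.prob_mem_constraintSpan b)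
  have hr0 : (0 : ℝ) < r := by exact_mod_cast hr
  have hq3 : 4096 * (B.queries : ℝ) ^ 3 ≤ r := by
    have h1 : (16 * (B.queries : ℝ)) ^ 3 ≤ ((r : ℝ) ^ (1 / 3 : ℝ)) ^ 3 :=
      pow_le_pow_left₀ (by positivity) (by linarith) 3
    rw [← Real.rpow_natCast, ← Real.rpow_natCast, ← Real.rpow_mul hr0.le] at h1
    norm_num at h1
    linarith [show (16 * (B.queries : ℝ)) ^ 3 = 4096 * (B.queries : ℝ) ^ 3 by ring]
  have hq3' : 4096 * B.queries ^ 3 ≤ r := by exact_mod_cast hq3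
  have heval : ∀ s : ℕ, 1 ≤ s → s ≤ r →
      P.eval (s : ℂ)⁻¹ = (expectSmallRange n s (fun C => B.prob C b) : ℂ) := by
    intro s hs hsr
    rw [← hsmall s hs (hsr.trans hrn), expectSmallRange]
    push_cast
    rfl
  have hzero : P.eval 0 = (expectPerm n (fun π => B.prob π b) : ℂ) := by
    rw [← hperm, expectPerm]
    push_cast
    rfl
  have key := norm_eval_zero_sub_le (2 * B.queries) r (by rw [mul_pow]; omega) hr P
    (by exact_mod_cast hdeg) (by
      intro s hs hsr
      rw [heval s hs hsr, heval r hr le_rfl, ← Complex.ofReal_sub, Complex.norm_real,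
        Real.norm_eq_abs, abs_le]
      have a1 := expectSmallRange_nonneg (n := n) (r := s) (fun C => B.prob_nonneg C b)
      have a2 := expectSmallRange_nonneg (n := n) (r := r) (fun C => B.prob_nonneg C b)
      have a3 := expectSmallRange_le_one hs (hsr.trans hrn) (fun C => B.prob_le_one C b)
      have a4 := expectSmallRange_le_one hr hrn (fun C => B.prob_le_one C b)
      constructor <;> linarith)
  rw [hzero, heval r hr le_rfl, ← Complex.ofReal_sub, Complex.norm_real, Real.norm_eq_abs] at key
  refine key.trans ?_
  rw [div_le_iff₀ hr0]
  push_cast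
  nlinarith

end QueryComplexity
end

/-! ### Building quantum algorithms -/

noncomputable section

namespace QueryComplexity

open Finset
open scoped BigOperators Matrix

/-- The families of states `ψ x` that can be prepared with `q` queries to `x`. The workspace is an
arbitrary finite type, and unitaries may be applied any number of times between queries; by
`Preparable.exists_algorithm` such a family comes from a `QuantumAlgorithm` with `q` queries. -/
inductive Preparable {n M : ℕ} {W : Type} [Fintype W] [DecidableEq W] :
    ℕ → ((Fin n → Fin M) → (Fin n × Fin M × W → ℂ)) → Prop
  | basis (b : Fin n × Fin M × W) : Preparable 0 (fun _ => Pi.single b 1)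
  | unitary {q ψ} (U : Matrix.unitaryGroup (Fin n × Fin M × W) ℂ) :
      Preparable q ψ → Preparable q (fun x => U.1 *ᵥ ψ x)
  | query {q ψ} : Preparable q ψ →
      Preparable (q + 1) (fun x b => ψ x (b.1, b.2.1 - x b.1, b.2.2))

theorem QuantumAlgorithm.state_congr {n M q q' w : ℕ} {start : QBasis n M w}
    {U U' : ℕ → Matrix.unitaryGroup (QBasis n M w) ℂ} {out out' : QBasis n M w → Bool} (k : ℕ)
    (h : ∀ i ≤ k, U i = U' i) (x : Fin n → Fin M) :
    (⟨q, w, start, U, out⟩ : QuantumAlgorithm n M).state x k =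
      (⟨q', w, start, U', out'⟩ : QuantumAlgorithm n M).state x k := by
  induction k with
  | zero => simp only [QuantumAlgorithm.state, h 0 le_rfl]
  | succ k ih =>
    simp only [QuantumAlgorithm.state, h (k + 1) le_rfl]
    rw [ih fun i hi => h i (by omega)]

theorem submatrix_mem_unitaryGroup {ι κ : Type*} [Fintype ι] [DecidableEq ι] [Fintype κ]
    [DecidableEq κ] (e : κ ≃ ι) {U : Matrix ι ι ℂ} (hU : U ∈ Matrix.unitaryGroup ι ℂ) :
    U.submatrix e e ∈ Matrix.unitaryGroup κ ℂ := by
  rw [Matrix.mem_unitaryGroup_iff] at hU ⊢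
  rw [Matrix.star_eq_conjTranspose, Matrix.conjTranspose_submatrix, Matrix.submatrix_mul_equiv,
    ← Matrix.star_eq_conjTranspose, hU, Matrix.submatrix_one_equiv]

theorem permMatrix_mem_unitaryGroup {ι : Type*} [Fintype ι] [DecidableEq ι] (σ : Equiv.Perm ι) :
    σ.permMatrix ℂ ∈ Matrix.unitaryGroup ι ℂ := by
  rw [Matrix.mem_unitaryGroup_iff, Matrix.star_eq_conjTranspose, Matrix.conjTranspose_permMatrix,
    ← Matrix.permMatrix_mul]
  simp

theorem Preparable.perm {n M q : ℕ} {W : Type} [Fintype W] [DecidableEq W]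
    {ψ : (Fin n → Fin M) → (Fin n × Fin M × W → ℂ)} (h : Preparable q ψ)
    (σ : Equiv.Perm (Fin n × Fin M × W)) : Preparable q (fun x b => ψ x (σ b)) := by
  have := h.unitary ⟨σ.permMatrix ℂ, permMatrix_mem_unitaryGroup σ⟩
  simpa only [Matrix.permMatrix_mulVec, Function.comp_def] using this

/-- A unitary applied after the `q`-th query is absorbed into `U q`. -/
theorem Preparable.exists_state {n M q : ℕ} {W : Type} [Fintype W] [DecidableEq W]
    {ψ : (Fin n → Fin M) → (Fin n × Fin M × W → ℂ)} (h : Preparable q ψ) {w : ℕ} (e : W ≃ Fin w) :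
    ∃ (start : QBasis n M w) (U : ℕ → Matrix.unitaryGroup (QBasis n M w) ℂ),
      ∀ out x v, (⟨q, w, start, U, out⟩ : QuantumAlgorithm n M).state x q v =
        ψ x (v.1, v.2.1, e.symm v.2.2) := by
  set E : QBasis n M w ≃ Fin n × Fin M × W :=
    Equiv.prodCongr (Equiv.refl _) (Equiv.prodCongr (Equiv.refl _) e.symm) with hE
  induction h with
  | basis b =>
    refine ⟨E.symm b, fun _ => 1, fun out x v => ?_⟩
    change ((1 : Matrix _ _ ℂ) *ᵥ Pi.single (E.symm b) 1) v =
      (Pi.single b 1 : Fin n × Fin M × W → ℂ) (E v)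
    rw [Matrix.one_mulVec]
    simp only [Pi.single_apply, Equiv.eq_symm_apply]
  | @unitary q ψ V _ ih =>
    obtain ⟨start, U, hU⟩ := ih
    refine ⟨start, fun k => if k = q then
      ⟨V.1.submatrix E E, submatrix_mem_unitaryGroup E V.2⟩ * U q else U k, fun out x v => ?_⟩
    have key : (⟨q, w, start, fun k => if k = q then
        ⟨V.1.submatrix E E, submatrix_mem_unitaryGroup E V.2⟩ * U q else U k, out⟩ :
          QuantumAlgorithm n M).state x q = V.1.submatrix E E *ᵥ
        (⟨q, w, start, U, out⟩ : QuantumAlgorithm n M).state x q := by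
      cases q with
      | zero =>
        simp only [QuantumAlgorithm.state, if_true, Matrix.mulVec_mulVec]
        rfl
      | succ q =>
        simp only [QuantumAlgorithm.state, if_true, Matrix.mulVec_mulVec]
        rw [QuantumAlgorithm.state_congr (q' := q + 1) (out' := out) (U' := U) q
          (fun i hi => if_neg (by omega)), ← Matrix.mul_assoc]
        rfl
    have hU' : (⟨q, w, start, U, out⟩ : QuantumAlgorithm n M).state x q = ψ x ∘ E :=
      funext fun v => hU out x v
    rw [key, hU', Matrix.submatrix_mulVec_equiv]
    simp only [Function.comp_def, Equiv.apply_symm_apply]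
    rfl
  | @query q ψ _ ih =>
    obtain ⟨start, U, hU⟩ := ih
    refine ⟨start, fun k => if k = q + 1 then 1 else U k, fun out x v => ?_⟩
    rw [QuantumAlgorithm.state]
    simp only [if_true]
    rw [QuantumAlgorithm.state_congr (q' := q) (out' := out) (U' := U) q
      (fun i hi => if_neg (by omega))]
    rw [OneMemClass.coe_one, Matrix.one_mulVec, oracle_mulVec, hU]

theorem Preparable.exists_algorithm {n M q : ℕ} {W : Type} [Fintype W] [DecidableEq W]
    {ψ : (Fin n → Fin M) → (Fin n × Fin M × W → ℂ)} (h : Preparable q ψ)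
    (out : Fin n × Fin M × W → Bool) :
    ∃ A : QuantumAlgorithm n M, A.queries = q ∧
      ∀ x b, A.prob x b = ∑ v with out v = b, ‖ψ x v‖ ^ 2 := by
  obtain ⟨start, U, hU⟩ := h.exists_state (Fintype.equivFin W)
  let E : QBasis n M (Fintype.card W) ≃ Fin n × Fin M × W :=
    Equiv.prodCongr (Equiv.refl _) (Equiv.prodCongr (Equiv.refl _) (Fintype.equivFin W).symm)
  refine ⟨⟨q, Fintype.card W, start, U, fun v => out (E v)⟩, rfl, fun x b => ?_⟩
  simp only [QuantumAlgorithm.prob, hU]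
  refine sum_equiv E (fun v => by simp) (fun v _ => rfl)

theorem Preparable.single_perm {n M q : ℕ} {W : Type} [Fintype W] [DecidableEq W]
    {b : (Fin n → Fin M) → Fin n × Fin M × W} (h : Preparable q fun x => Pi.single (b x) 1)
    (σ : Equiv.Perm (Fin n × Fin M × W)) : Preparable q fun x => Pi.single (σ (b x)) 1 := by
  convert h.perm σ.symm using 3 with x v
  simp only [Pi.single_apply, Equiv.symm_apply_eq]

theorem Preparable.single_query {n M q : ℕ} {W : Type} [Fintype W] [DecidableEq W]
    {b : (Fin n → Fin M) → Fin n × Fin M × W} (h : Preparable q fun x => Pi.single (b x) 1) :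
    Preparable (q + 1) fun x =>
      Pi.single ((b x).1, (b x).2.1 + x (b x).1, (b x).2.2) 1 := by
  convert h.query using 3 with x v
  have : NeZero M := ⟨by have := v.2.1.pos; omega⟩
  simp only [Pi.single_apply]
  congr 1
  apply propext
  constructor
  · rintro rfl; simp
  · intro h; simp [← h]

/-- For a fixed position register, exchange the answer register with the entry at `i` of a table kept
in the workspace. -/
def exchangeAt {n M : ℕ} (i : Fin n) : Equiv.Perm (Fin n × Fin M × (Fin n → Fin M)) :=
  Function.Involutive.toPerm (fun b => (b.1, b.2.2 i, Function.update b.2.2 i b.2.1)) (by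
    intro b; simp)

theorem exchangeAt_apply {n M : ℕ} (i : Fin n) (b : Fin n × Fin M × (Fin n → Fin M)) :
    exchangeAt i b = (b.1, b.2.2 i, Function.update b.2.2 i b.2.1) := rfl

/-- Querying all positions one after the other and storing the answers in a table computes every
`f`. So `Q f = 0` can only occur for a constant `f` when there is a quantum register at all. -/
theorem exists_quantumComputable {n M : ℕ} (hn : 0 < n) (hM : 0 < M) {S : Set (Fin n → Fin M)}
    (f : S → Bool) : ∃ q, QuantumComputable f q := by
  classical
  have : NeZero n := ⟨hn.ne'⟩
  have : NeZero M := ⟨hM.ne'⟩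
  have key : ∀ s : Finset (Fin n), Preparable #s fun x : Fin n → Fin M =>
      Pi.single ((0 : Fin n), (0 : Fin M), fun i => if i ∈ s then x i else 0) 1 := by
    intro s
    induction s using Finset.induction_on with
    | empty => simpa using Preparable.basis ((0 : Fin n), (0 : Fin M), fun _ : Fin n => (0 : Fin M))
    | insert i s hi ih =>
      rw [card_insert_of_notMem hi]
      have h := (((ih.single_perm (Equiv.prodCongr (Equiv.swap 0 i) (Equiv.refl _))).single_query
        ).single_perm (exchangeAt i)).single_perm (Equiv.prodCongr (Equiv.swap 0 i) (Equiv.refl _))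
      have e : ∀ x : Fin n → Fin M, Function.update (fun j => if j ∈ s then x j else 0) i (x i) =
          fun j => if j ∈ insert i s then x j else 0 := by
        intro x
        funext j
        by_cases hj : j = i
        · subst hj; simp
        · simp [hj]
      simpa [exchangeAt_apply, hi, e] using h
  obtain ⟨A, -, hA⟩ := (key univ).exists_algorithm
    (fun v => if h : v.2.2 ∈ S then f ⟨v.2.2, h⟩ else false)
  refine ⟨A.queries, A, rfl, fun x => ?_⟩
  rw [hA, sum_eq_single_of_mem (0, 0, fun i => if i ∈ univ then x.1 i else 0)]
  · simp; norm_num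
  · simp
  · intro b _ hb
    simp only [Pi.single_apply, if_neg hb]; simp

theorem kronecker_one_mulVec {ι κ : Type*} [Fintype ι] [Fintype κ] [DecidableEq κ]
    (U : Matrix ι ι ℂ) (a : ι → ℂ) (b : κ → ℂ) :
    Matrix.kroneckerMap (· * ·) U (1 : Matrix κ κ ℂ) *ᵥ (fun p => a p.1 * b p.2) =
      fun p => (U *ᵥ a) p.1 * b p.2 := by
  funext p
  simp only [Matrix.mulVec, dotProduct, Fintype.sum_prod_type, Matrix.kroneckerMap_apply,
    Matrix.one_apply, sum_mul]
  refine sum_congr rfl fun i _ => ?_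
  rw [sum_eq_single p.2]
  · simp; ring
  · intro k _ hk; simp [hk.symm]
  · simp

/-- The state `χ ⊗ η` of an algorithm with inputs in `[n] → [M]` together with an ancilla, placed in
the basis of an algorithm that queries a function `[n] → [n]`: the position register is shared, the
answer register of the outer algorithm is `0`, and that of the inner algorithm is workspace. -/
def withClearAnswer {n M w : ℕ} {E : Type} [NeZero n] (χ : QBasis n M w → ℂ) (η : E → ℂ)
    (v : Fin n × Fin n × (Fin M × Fin w × E)) : ℂ :=
  if v.2.1 = 0 then χ (v.1, v.2.2.1, v.2.2.2.1) * η v.2.2.2.2 else 0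

section Simulation

variable {n M w q : ℕ} {E : Type} [Fintype E] [DecidableEq E] [NeZero n]
  {χ : (Fin n → Fin n) → QBasis n M w → ℂ} {η : (Fin n → Fin n) → E → ℂ}

theorem Preparable.withClearAnswer_unitary
    (h : Preparable q fun C => withClearAnswer (χ C) (η C))
    (U : Matrix.unitaryGroup (QBasis n M w) ℂ) :
    Preparable q fun C => withClearAnswer (U.1 *ᵥ χ C) (η C) := by
  let e : Fin n × Fin n × (Fin M × Fin w × E) ≃ QBasis n M w × (Fin n × E) :=
    { toFun := fun v => ((v.1, v.2.2.1, v.2.2.2.1), (v.2.1, v.2.2.2.2))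
      invFun := fun v => (v.1.1, v.2.1, v.1.2.1, v.1.2.2, v.2.2)
      left_inv := fun v => rfl
      right_inv := fun v => rfl }
  have hU : Matrix.kroneckerMap (· * ·) U.1 (1 : Matrix (Fin n × E) (Fin n × E) ℂ) ∈
      Matrix.unitaryGroup (QBasis n M w × (Fin n × E)) ℂ :=
    Matrix.kronecker_mem_unitary U.2 (one_mem _)
  convert h.unitary ⟨_, submatrix_mem_unitaryGroup e hU⟩ using 2 with C
  have hw : ∀ χ' : QBasis n M w → ℂ, withClearAnswer χ' (η C) =
      (fun p : QBasis n M w × (Fin n × E) => χ' p.1 * if p.2.1 = 0 then η C p.2.2 else 0) ∘ e := by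
    intro χ'
    funext v
    simp [withClearAnswer, e]
  rw [Matrix.submatrix_mulVec_equiv, hw, hw, Function.comp_assoc, Equiv.self_comp_symm,
    Function.comp_id]
  exact congrArg (· ∘ e) (kronecker_one_mulVec U.1 (χ C)
    fun p : Fin n × E => if p.1 = 0 then η C p.2 else 0).symm

/-- One query to `x ∘ C` costs two queries to `C`: compute `C i` in the answer register, add `x (C i)`
to the inner answer register, and uncompute. As queries can only add `C i`, uncomputing means to
negate the answer register and to query again. -/
theorem Preparable.withClearAnswer_query [NeZero M]
    (h : Preparable q fun C => withClearAnswer (χ C) (η C)) (x : Fin n → Fin M) :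
    Preparable (q + 2) fun C => withClearAnswer (oracle w (x ∘ C) *ᵥ χ C) (η C) := by
  -- as `Preparable.perm` composes with the permutation on amplitudes, a subtraction here adds
  -- `x` to the register
  let add : Equiv.Perm (Fin n × Fin n × (Fin M × Fin w × E)) :=
    { toFun := fun v => (v.1, v.2.1, v.2.2.1 - x v.2.1, v.2.2.2)
      invFun := fun v => (v.1, v.2.1, v.2.2.1 + x v.2.1, v.2.2.2)
      left_inv := fun v => by simp
      right_inv := fun v => by simp }
  let neg : Equiv.Perm (Fin n × Fin n × (Fin M × Fin w × E)) :=
    Equiv.prodCongr (Equiv.refl _) (Equiv.prodCongr (Equiv.neg _) (Equiv.refl _))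
  convert ((h.query.perm add).perm neg).query using 3 with C v
  simp only [withClearAnswer, add, neg, Equiv.coe_fn_mk, Equiv.prodCongr_apply, Prod.map_apply,
    Equiv.neg_apply, Equiv.coe_refl, id_eq, oracle_mulVec, neg_sub, sub_sub_cancel_left,
    neg_eq_zero, Function.comp_apply]
  by_cases hv : v.2.1 = 0
  · simp [hv]
  · simp [hv]

theorem Preparable.run_subroutine [NeZero M] (A : QuantumAlgorithm n M) (x : Fin n → Fin M)
    (h : Preparable q fun C => withClearAnswer (Pi.single A.start 1) (η C)) (k : ℕ) :
    Preparable (q + 2 * k) fun C => withClearAnswer (A.state (x ∘ C) k) (η C) := by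
  induction k with
  | zero => exact h.withClearAnswer_unitary (A.U 0)
  | succ k ih => exact (ih.withClearAnswer_query x).withClearAnswer_unitary (A.U (k + 1))

end Simulation

/-- Cyclically permute three copies of the registers of an algorithm, one active and two stored in
the ancilla, so that the next copy becomes active. -/
def cycleRegisters (n M w : ℕ) :
    Equiv.Perm (Fin n × Fin n × (Fin M × Fin w × (QBasis n M w × QBasis n M w))) where
  toFun v := (v.2.2.2.2.1.1, v.2.1, v.2.2.2.2.1.2.1, v.2.2.2.2.1.2.2,
    v.2.2.2.2.2, (v.1, v.2.2.1, v.2.2.2.1))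
  invFun v := (v.2.2.2.2.2.1, v.2.1, v.2.2.2.2.2.2.1, v.2.2.2.2.2.2.2,
    (v.1, v.2.2.1, v.2.2.2.1), v.2.2.2.2.1)
  left_inv _ := rfl
  right_inv _ := rfl

theorem Preparable.cycle {n M w q : ℕ} [NeZero n] {χ₁ χ₂ χ₃ : (Fin n → Fin n) → QBasis n M w → ℂ}
    (h : Preparable q fun C => withClearAnswer (χ₁ C)
      fun e : QBasis n M w × QBasis n M w => χ₂ C e.1 * χ₃ C e.2) :
    Preparable q fun C => withClearAnswer (χ₃ C)
      fun e : QBasis n M w × QBasis n M w => χ₁ C e.1 * χ₂ C e.2 := by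
  convert h.perm (cycleRegisters n M w) using 3 with C v
  simp only [withClearAnswer, cycleRegisters, Equiv.coe_fn_mk]
  congr 1
  ring

/-- The majority of three bits. -/
def majority (a b c : Bool) : Bool := (a && b) || (b && c) || (c && a)

/-- The majority vote of three runs of `A` on `x ∘ C`, as an algorithm that queries `C`: three runs,
and two queries to `C` for each query to `x ∘ C`. -/
theorem exists_majority_algorithm {n M : ℕ} (A : QuantumAlgorithm n M) (x : Fin n → Fin M) :
    ∃ B : QuantumAlgorithm n n, B.queries = 6 * A.queries ∧ ∀ C b,
      B.prob C b = 3 * A.prob (x ∘ C) b ^ 2 - 2 * A.prob (x ∘ C) b ^ 3 := by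
  have : NeZero n := ⟨by have := A.start.1.pos; omega⟩
  have : NeZero M := ⟨by have := A.start.2.1.pos; omega⟩
  set st : QBasis n M A.workDim → ℂ := Pi.single A.start 1 with hst
  set ψ : (Fin n → Fin n) → QBasis n M A.workDim → ℂ := fun C => A.state (x ∘ C) A.queries with hψ
  have h0 : Preparable 0 fun C : Fin n → Fin n =>
      withClearAnswer st fun e : QBasis n M A.workDim × QBasis n M A.workDim =>
        st e.1 * st e.2 := by
    convert Preparable.basis (n := n) (M := n)
      (A.start.1, (0 : Fin n), (A.start.2.1, A.start.2.2, (A.start, A.start))) using 2 with C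
    funext v
    obtain ⟨i, j, m, k, e1, e2⟩ := v
    simp only [withClearAnswer, hst, Pi.single_apply, Prod.ext_iff]
    split_ifs <;> simp_all
  have h1 := (h0.run_subroutine A x A.queries).cycle (χ₁ := ψ) (χ₂ := fun _ => st)
    (χ₃ := fun _ => st)
  have h2 := (h1.run_subroutine A x A.queries).cycle (χ₁ := ψ) (χ₂ := ψ) (χ₃ := fun _ => st)
  have h3 := h2.run_subroutine A x A.queries
  obtain ⟨B, hBq, hB⟩ := h3.exists_algorithm (fun v =>
    majority (A.out (v.1, v.2.2.1, v.2.2.2.1)) (A.out v.2.2.2.2.1) (A.out v.2.2.2.2.2))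
  refine ⟨B, by omega, fun C b => ?_⟩
  rw [hB]
  set p : QBasis n M A.workDim → ℝ := fun v => ‖ψ C v‖ ^ 2 with hp
  -- the three copies, followed by the answer register, which is `0`
  let e : (QBasis n M A.workDim × QBasis n M A.workDim × QBasis n M A.workDim) × Fin n ≃
      Fin n × Fin n × (Fin M × Fin A.workDim × (QBasis n M A.workDim × QBasis n M A.workDim)) :=
    { toFun := fun v => (v.1.1.1, v.2, v.1.1.2.1, v.1.1.2.2, v.1.2.1, v.1.2.2)
      invFun := fun v => (((v.1, v.2.2.1, v.2.2.2.1), v.2.2.2.2.1, v.2.2.2.2.2), v.2.1)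
      left_inv := fun v => rfl
      right_inv := fun v => rfl }
  have hsum : ∑ v : Fin n × Fin n × (Fin M × Fin A.workDim ×
      (QBasis n M A.workDim × QBasis n M A.workDim)) with majority (A.out (v.1, v.2.2.1, v.2.2.2.1)) (A.out v.2.2.2.2.1)
      (A.out v.2.2.2.2.2) = b, ‖withClearAnswer (A.state (x ∘ C) A.queries)
        (fun e : QBasis n M A.workDim × QBasis n M A.workDim => ψ C e.1 * ψ C e.2) v‖ ^ 2 =
      ∑ v₁, ∑ v₂, ∑ v₃, if majority (A.out v₁) (A.out v₂) (A.out v₃) = b then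
        p v₁ * (p v₂ * p v₃) else 0 := by
    rw [sum_filter, ← e.sum_comp, Fintype.sum_prod_type, Fintype.sum_prod_type]
    refine sum_congr rfl fun v₁ _ => ?_
    rw [Fintype.sum_prod_type]
    refine sum_congr rfl fun v₂ _ => sum_congr rfl fun v₃ _ => ?_
    rw [sum_eq_single 0]
    · simp [e, withClearAnswer, hp, hψ, mul_pow]
    · intro j _ hj
      simp [e, withClearAnswer, hj]
    · simp
  rw [hsum]
  have hP : ∀ c, A.prob (x ∘ C) c = ∑ v, if A.out v = c then p v else 0 := by
    intro c
    rw [QuantumAlgorithm.prob, sum_filter]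
  have hbit : ∀ F : Bool → ℝ, ∑ v, p v * F (A.out v) =
      A.prob (x ∘ C) b * F b + A.prob (x ∘ C) (!b) * F (!b) := by
    intro F
    rw [hP, hP, sum_mul, sum_mul, ← sum_add_distrib]
    refine sum_congr rfl fun v _ => ?_
    cases A.out v <;> cases b <;> simp
  set G : Bool → Bool → Bool → ℝ := fun c₁ c₂ c₃ => if majority c₁ c₂ c₃ = b then 1 else 0 with hG
  have hfac : ∀ v₁ v₂ v₃, (if majority (A.out v₁) (A.out v₂) (A.out v₃) = b then
      p v₁ * (p v₂ * p v₃) else 0) =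
        p v₁ * (p v₂ * (p v₃ * G (A.out v₁) (A.out v₂) (A.out v₃))) := by
    intro v₁ v₂ v₃
    simp only [hG]
    split_ifs <;> ring
  simp only [hfac, ← mul_sum]
  simp only [fun c₁ c₂ => hbit (G c₁ c₂)]
  simp only [fun c₁ => hbit fun c₂ => A.prob (x ∘ C) b * G c₁ c₂ b +
    A.prob (x ∘ C) (!b) * G c₁ c₂ (!b)]
  rw [hbit fun c₁ => A.prob (x ∘ C) b * (A.prob (x ∘ C) b * G c₁ b b +
      A.prob (x ∘ C) (!b) * G c₁ b (!b)) + A.prob (x ∘ C) (!b) * (A.prob (x ∘ C) b * G c₁ (!b) b +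
      A.prob (x ∘ C) (!b) * G c₁ (!b) (!b))]
  have hnot : A.prob (x ∘ C) (!b) = 1 - A.prob (x ∘ C) b := by
    linarith [A.prob_add_prob_not (x ∘ C) b]
  rw [hnot]
  cases b <;> simp [hG, majority] <;> ring

end QueryComplexity
end

/-! ### Classical simulation -/

noncomputable section

namespace QueryComplexity

open Finset
open scoped BigOperators ENNReal

/-- Query the positions `h 0, …, h (r - 1)` and output the bit that `β` assigns to the list of
answers. -/
def queryAll {n M : ℕ} : (r : ℕ) → (Fin r → Fin n) → ((Fin r → Fin M) → Bool) → DecisionTree n M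
  | 0, _, β => .leaf (β Fin.elim0)
  | r + 1, h, β => .query (h 0) fun a => queryAll r (h ∘ Fin.succ) fun v => β (Fin.cons a v)

theorem eval_queryAll {n M : ℕ} (x : Fin n → Fin M) (r : ℕ) (h : Fin r → Fin n)
    (β : (Fin r → Fin M) → Bool) : (queryAll r h β).eval x = β (x ∘ h) := by
  induction r with
  | zero => simp only [queryAll, DecisionTree.eval]; congr 1; exact Subsingleton.elim _ _
  | succ r ih =>
    simp only [queryAll, DecisionTree.eval]
    rw [ih]
    congr 1
    funext i
    refine Fin.cases ?_ (fun j => ?_) i <;> simp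

theorem depth_queryAll_le {n M : ℕ} (r : ℕ) (h : Fin r → Fin n)
    (β : (Fin r → Fin M) → Bool) : (queryAll r h β).depth ≤ r := by
  induction r with
  | zero => simp [queryAll, DecisionTree.depth]
  | succ r ih =>
    simp only [queryAll, DecisionTree.depth]
    have : (univ.sup fun a : Fin M =>
        (queryAll r (h ∘ Fin.succ) fun v => β (Fin.cons a v)).depth) ≤ r :=
      Finset.sup_le fun a _ => ih _ _
    omega

/-- Independent random bits, the one with index `v` having distribution `p v`. -/
def independentBits {V : Type*} [Fintype V] [DecidableEq V] (p : V → PMF Bool) : PMF (V → Bool) :=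
  PMF.ofFintype (fun β => ∏ v, p v (β v)) (by
    rw [← Fintype.piFinset_univ, ← prod_univ_sum]
    refine prod_eq_one fun v _ => ?_
    rw [← tsum_fintype (L := .unconditional Bool)]; exact (p v).tsum_coe)

theorem independentBits_map_eval {V : Type*} [Fintype V] [DecidableEq V] (p : V → PMF Bool)
    (v : V) : (independentBits p).map (fun β => β v) = p v := by
  ext b
  rw [PMF.map_apply, tsum_fintype]
  have h : ∀ β : V → Bool, (if b = β v then independentBits p β else 0) =
      ∏ u, if u = v then (if b = β u then p u (β u) else 0) else p u (β u) := by
    intro β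
    split_ifs with hb
    · rw [independentBits, PMF.ofFintype_apply]
      refine prod_congr rfl fun u _ => ?_
      split_ifs with hu hbu
      · rfl
      · subst hu; exact absurd hb hbu
      · rfl
    · symm
      apply prod_eq_zero (mem_univ v)
      simp [hb]
  trans ∑ β : V → Bool, ∏ u, if u = v then (if b = β u then p u (β u) else 0) else p u (β u)
  · refine sum_congr rfl fun β _ => ?_
    rw [← h β]
    congr
  rw [← Fintype.piFinset_univ,
    ← prod_univ_sum (fun _ => univ) fun u c => if u = v then (if b = c then p u c else 0) else p u c,
    prod_eq_single v]
  · simp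
  · intro u _ hu
    simp only [if_neg hu]
    rw [← tsum_fintype (L := .unconditional Bool)]; exact (p u).tsum_coe
  · simp

/-- A randomized algorithm may draw `r` positions from a distribution and, after querying them, output
a random bit whose distribution depends on the answers. As a distribution over decision trees, the
random bits for all possible answers are drawn in advance. -/
theorem randomizedComputable_of_sample {n M r : ℕ} {S : Set (Fin n → Fin M)} (f : S → Bool)
    {Ω : Type} (μ : PMF Ω) (h : Ω → Fin r → Fin n) (p : Ω → (Fin r → Fin M) → PMF Bool)
    (hp : ∀ x : S, (2 / 3 : ℝ≥0∞) ≤ (μ.bind fun ω => p ω (x.1 ∘ h ω)) (f x)) :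
    RandomizedComputable f r := by
  refine ⟨μ.bind fun ω => (independentBits (p ω)).map (queryAll r (h ω)), ?_, fun x => ?_⟩
  · intro T hT
    rw [PMF.mem_support_bind_iff] at hT
    obtain ⟨ω, -, hT⟩ := hT
    rw [PMF.mem_support_map_iff] at hT
    obtain ⟨β, -, rfl⟩ := hT
    exact depth_queryAll_le _ _ _
  · rw [PMF.map_bind]
    convert hp x using 4 with ω
    rw [PMF.map_comp, ← independentBits_map_eval (p ω)]
    congr 1
    funext β
    exact eval_queryAll _ _ _ _

theorem randomizedComputable_all {n M : ℕ} {S : Set (Fin n → Fin M)} (f : S → Bool) :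
    RandomizedComputable f n := by
  classical
  refine ⟨PMF.pure (queryAll n id fun v => if h : v ∈ S then f ⟨v, h⟩ else false), ?_, fun x => ?_⟩
  · intro T hT
    rw [PMF.mem_support_pure_iff] at hT
    rw [hT]
    exact depth_queryAll_le _ _ _
  · rw [PMF.pure_map, eval_queryAll]
    simp
    exact ENNReal.div_le_of_le_mul (by norm_num)

theorem randomizedComputable_zero_of_const {n M : ℕ} {S : Set (Fin n → Fin M)} {f : S → Bool}
    (hf : ∀ x y, f x = f y) : RandomizedComputable f 0 := by
  classical
  refine ⟨PMF.pure (.leaf (if h : ∃ x, f x = true then true else false)), ?_, fun x => ?_⟩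
  · intro T hT
    rw [PMF.mem_support_pure_iff] at hT
    rw [hT]
    exact le_rfl
  · have hx : (if h : ∃ x, f x = true then true else false) = f x := by
      split_ifs with h
      · obtain ⟨y, hy⟩ := h
        rw [hf x y, hy]
      · push Not at h
        simpa using (h x).symm
    rw [PMF.pure_map, DecisionTree.eval, hx]
    simp
    exact ENNReal.div_le_of_le_mul (by norm_num)

/-- The distribution of the output bit of the quantum algorithm `B` run with the oracle of `C`. -/
def QuantumAlgorithm.outputPMF {n M : ℕ} (B : QuantumAlgorithm n M) (C : Fin n → Fin M) : PMF Bool :=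
  PMF.ofFintype (fun b => ENNReal.ofReal (B.prob C b)) (by
    rw [Fintype.sum_bool, ← ENNReal.ofReal_add (B.prob_nonneg _ _) (B.prob_nonneg _ _)]
    have := B.prob_add_prob_not C true
    simp only [Bool.not_true] at this
    simp [this])

theorem bind_uniform_outputPMF {n r : ℕ} [Nonempty (Fin r)] [Nonempty (Fin r ↪ Fin n)]
    (B : QuantumAlgorithm n n) (b : Bool) :
    ((PMF.uniformOfFintype ((Fin n → Fin r) × (Fin r ↪ Fin n))).bind fun ω =>
      B.outputPMF (ω.2 ∘ ω.1)) b = ENNReal.ofReal (expectSmallRange n r fun C => B.prob C b) := by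
  have h := expect_product' (M := ℝ) univ univ fun (g : Fin n → Fin r) (h : Fin r ↪ Fin n) =>
      B.prob (h ∘ g) b
  rw [univ_product_univ, Fintype.expect_eq_sum_div_card] at h
  rw [PMF.bind_apply, tsum_fintype, expectSmallRange, ← h, sum_div,
    ENNReal.ofReal_sum_of_nonneg fun ω _ => div_nonneg (B.prob_nonneg _ _) (by positivity)]
  refine sum_congr rfl fun ω _ => ?_
  rw [PMF.uniformOfFintype_apply, QuantumAlgorithm.outputPMF, PMF.ofFintype_apply,
    ENNReal.ofReal_div_of_pos (by exact_mod_cast Fintype.card_pos), ENNReal.ofReal_natCast,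
    mul_comm, div_eq_mul_inv]

theorem R_le {n M q : ℕ} {S : Set (Fin n → Fin M)} {f : S → Bool} (h : RandomizedComputable f q) :
    R f ≤ q := Nat.sInf_le h

theorem const_of_quantumComputable_zero {n M : ℕ} {S : Set (Fin n → Fin M)} {f : S → Bool}
    (h : QuantumComputable f 0) (x y : S) : f x = f y := by
  obtain ⟨A, hA0, hA⟩ := h
  by_contra hne
  have hxy : A.prob y.1 (f y) = A.prob x.1 (!(f x)) := by
    have : f y = !(f x) := Bool.eq_not.2 (Ne.symm hne)
    rw [this, QuantumAlgorithm.prob, QuantumAlgorithm.prob, hA0]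
    rfl
  have h1 := hA x
  have h2 := hA y
  rw [hxy] at h2
  linarith [A.prob_add_prob_not x.1 (f x)]

theorem const_of_Q_eq_zero {n M : ℕ} {S : Set (Fin n → Fin M)} {f : S → Bool} (hQ : Q f = 0)
    (x y : S) : f x = f y := by
  rcases Nat.sInf_eq_zero.1 hQ with h | h
  · exact const_of_quantumComputable_zero h x y
  · -- no quantum algorithm exists, so there is at most one input
    have hxy : x = y := by
      apply Subtype.ext
      funext i
      have hn : 0 < n := i.pos
      have hM : 0 < M := (x.1 i).pos
      obtain ⟨q, hq⟩ := exists_quantumComputable hn hM f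
      exact absurd (show q ∈ {q | QuantumComputable f q} from hq) (by rw [h]; simp)
    rw [hxy]

theorem quantumComputable_Q {n M : ℕ} {S : Set (Fin n → Fin M)} {f : S → Bool} (hQ : Q f ≠ 0) :
    QuantumComputable f (Q f) :=
  Nat.sInf_mem (Nat.nonempty_of_pos_sInf (Nat.pos_of_ne_zero hQ))

/-- Draw an injection `h : [r] → [n]` and `g : [n] → [r]`, query the input `x` on the range of `h`, and
simulate on `x ∘ h ∘ g` the majority vote of three runs of the quantum algorithm. On `x ∘ π` for a
random permutation `π` the vote is correct with probability at least `20/27`, and replacing `π` by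
`h ∘ g` loses at most `2/27`. -/
theorem randomizedComputable_of_quantumComputable {Λ : ℝ} (hΛ : IsZhandryConstant Λ) {n M q r : ℕ}
    {S : Set (Fin n → Fin M)} {f : S → Bool} (hf : PermutationSymmetric f)
    (hq : QuantumComputable f q) (hr : 1 ≤ r) (hrn : r ≤ n)
    (hqr : 6 * (q : ℝ) ≤ Λ * (r : ℝ) ^ (1 / 3 : ℝ)) : RandomizedComputable f r := by
  obtain ⟨A, rfl, hA⟩ := hq
  have : Nonempty (Fin r ↪ Fin n) := ⟨Fin.castLEEmb hrn⟩
  have : Nonempty (Fin r) := ⟨⟨0, hr⟩⟩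
  -- `B y` hard-wires `y` and takes the majority vote of three runs of `A` on `y ∘ C`
  choose B hBq hB using fun y : Fin n → Fin M => exists_majority_algorithm A y
  refine randomizedComputable_of_sample f
    (PMF.uniformOfFintype ((Fin n → Fin r) × (Fin r ↪ Fin n))) (fun ω => ω.2)
    (fun ω v => (B (v ∘ ω.1)).outputPMF id) fun x => ?_
  have hout : ∀ ω : (Fin n → Fin r) × (Fin r ↪ Fin n),
      (B ((x.1 ∘ ω.2) ∘ ω.1)).outputPMF id = (B x.1).outputPMF (ω.2 ∘ ω.1) := by
    intro ω
    ext b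
    simp only [QuantumAlgorithm.outputPMF, PMF.ofFintype_apply, hB, Function.comp_id,
      Function.comp_assoc]
  simp only [hout]
  rw [bind_uniform_outputPMF]
  have hperm : 20 / 27 ≤ expectPerm n fun π => (B x.1).prob π (f x) := by
    refine le_expect univ_nonempty fun π _ => ?_
    obtain ⟨hπ, hfπ⟩ := hf π x
    have h1 : 2 / 3 ≤ A.prob (x.1 ∘ π) (f x) := by
      have := hA ⟨x.1 ∘ π, hπ⟩
      rwa [hfπ] at this
    have h2 := A.prob_le_one (x.1 ∘ π) (f x)
    change 20 / 27 ≤ (B x.1).prob π (f x)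
    rw [hB]
    set p := A.prob (x.1 ∘ π) (f x)
    -- `3 p² - 2 p³` is increasing on `[0, 1]` and equals `20/27` at `2/3`
    nlinarith [mul_nonneg (sub_nonneg.2 h1) (sub_nonneg.2 h2),
      mul_nonneg (mul_nonneg (sub_nonneg.2 h1) (sub_nonneg.2 h2)) (by linarith : 0 ≤ p)]
  have hclose := hΛ.2 n r hr hrn (B x.1) (by rw [hBq]; push_cast; exact hqr) (f x)
  have hfinal : 2 / 3 ≤ expectSmallRange n r fun C => (B x.1).prob C (f x) := by
    linarith [(abs_le.1 hclose).2]
  calc (2 / 3 : ℝ≥0∞) = ENNReal.ofReal (2 / 3) := by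
        rw [ENNReal.ofReal_div_of_pos (by norm_num)]; simp
    _ ≤ _ := ENNReal.ofReal_le_ofReal hfinal

theorem R_le_ceil {Λ : ℝ} (hΛ : IsZhandryConstant Λ) {n M : ℕ}
    {S : Set (Fin n → Fin M)} {f : S → Bool} (hf : PermutationSymmetric f) :
    R f ≤ ⌈216 * (Q f : ℝ) ^ 3 * Λ ^ (-3 : ℤ)⌉₊ := by
  have hΛ0 := hΛ.1
  by_cases hQ : Q f = 0
  · exact (R_le (randomizedComputable_zero_of_const (const_of_Q_eq_zero hQ))).trans (Nat.zero_le _)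
  set r := ⌈216 * (Q f : ℝ) ^ 3 * Λ ^ (-3 : ℤ)⌉₊ with hr
  by_cases hrn : n < r
  · exact (R_le (randomizedComputable_all f)).trans hrn.le
  have hQ0 : (0 : ℝ) < Q f := by exact_mod_cast Nat.pos_of_ne_zero hQ
  have hr1 : 1 ≤ r := Nat.one_le_ceil_iff.2 (by positivity)
  refine R_le (randomizedComputable_of_quantumComputable hΛ hf (quantumComputable_Q hQ) hr1
    (not_lt.1 hrn) ?_)
  have h1 : (6 * (Q f : ℝ) / Λ) ^ 3 ≤ r := by
    refine le_trans (le_of_eq ?_) (Nat.le_ceil _)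
    rw [zpow_neg, div_pow, mul_pow]
    norm_num
    rfl
  have h2 : 6 * (Q f : ℝ) / Λ ≤ (r : ℝ) ^ (1 / 3 : ℝ) := by
    calc 6 * (Q f : ℝ) / Λ = ((6 * (Q f : ℝ) / Λ) ^ 3) ^ (1 / 3 : ℝ) := by
          rw [← Real.rpow_natCast, ← Real.rpow_mul (by positivity)]; norm_num
      _ ≤ _ := by gcongr
  rwa [div_le_iff₀ hΛ0, mul_comm _ Λ] at h2

end QueryComplexity

theorem theorem2 :
    (∃ Λ : ℝ, QueryComplexity.IsZhandryConstant Λ) ∧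
    (∀ Λ : ℝ, QueryComplexity.IsZhandryConstant Λ →
      ∀ (n M : ℕ) (S : Set (Fin n → Fin M)) (f : S → Bool),
        QueryComplexity.PermutationSymmetric f →
          QueryComplexity.R f ≤ ⌈216 * (QueryComplexity.Q f : ℝ) ^ 3 * Λ ^ (-3 : ℤ)⌉₊) ∧
    (∃ K : ℝ, 0 < K ∧ ∀ (n M : ℕ) (S : Set (Fin n → Fin M)) (f : S → Bool),
        QueryComplexity.PermutationSymmetric f →
          (QueryComplexity.R f : ℝ) ≤ K * (QueryComplexity.Q f : ℝ) ^ 3) := by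
  have hz := QueryComplexity.isZhandryConstant_one_div_sixteen
  refine ⟨⟨_, hz⟩, fun Λ hΛ n M S f hf => QueryComplexity.R_le_ceil hΛ hf,
    216 * 16 ^ 3, by norm_num, fun n M S f hf => ?_⟩
  have h := QueryComplexity.R_le_ceil hz hf
  have hceil : 216 * (QueryComplexity.Q f : ℝ) ^ 3 * (1 / 16) ^ (-3 : ℤ) =
      ((216 * 16 ^ 3 * QueryComplexity.Q f ^ 3 : ℕ) : ℝ) := by
    push_cast
    norm_num
    ring
  rw [hceil, Nat.ceil_natCast] at h
  exact_mod_cast h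

end
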